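/- Fix a finite alphabet $\mathcal X$. A prefix machine is a partial computable function, on binary programs, with prefix-free domain. $K$ is prefix complexity with respect to an optimal prefix machine (the length of a shortest program that outputs a code of the object). A semimeasure is a function $\rho:\mathcal X^*\to[0,1]$ with $\rho(\epsilon)\le 1$ and $\sum_{a\in\mathcal X}\rho(xa)\le\rho(x)$ for all $x$; it is a measure if equality holds everywhere. It is (co-)enumerable if the set of pairs $(x,q)$, $q\in\mathbb Q$, with $\rho(x)>q$ (resp. $\rho(x)<q$) is recursively enumerable. A measure is computable if it is enumerable and co-enumerable and its zero set is decidable. Let $(\nu_T)_{T\in\mathbb N}$ be an effective enumeration of all enumerable semimeasures (the $\nu_T$ are enumerable uniformly in $T$), let $M(x)=\sum_T 2^{-K(T)}\nu_T(x)$ be Solomonoff's prior, and let $d_\mu(x)=\log_2\frac{M(x)}{\mu(x)}$ be the $\mu$-randomness deficiency of $x$. Conditional values are $\rho(y|x)=\rho(xy)/\rho(x)$; if $\mu(x)=0$, then $\mu(y|x)$ is arbitrary, $d_\mu(x)=\infty$, and $K(\lceil\infty\rceil):=\infty$ (so that the bound below is trivial). The complexity $K_*(n|x*)$, monotone in its condition,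 is defined in one of two ways. (a) A twice prefix machine $V$ reads its inputs, without delimiters, from two one-way tapes, the first binary and the second over $\mathcal X$; $V(p,x)=n$ means that, on tapes beginning with $p$ and $x$, it halts after reading exactly $p$ and $x$ and prints $n$. Put $C_V(n|x)=\min\{\ell(p)\mid\exists k\le\ell(x):V(p,x_{1:k})=n\}$, and $K_*(n|x*)=C_V(n|x)$ for a $V$ that is optimal, i.e. for every twice prefix machine $V'$ there is a constant $c'$ with $C_V(n|x)\le C_{V'}(n|x)+c'$ for all $n,x$. (b) A recursively enumerable set $E$ of triples $\langle p,x,n\rangle$ ($p\in\{0,1\}^*$, $x\in\mathcal X^*$, $n\in\mathbb N$) is $K_*$-correct if: (1) $\langle p,x,n_1\rangle,\langle p,x,n_2\rangle\in E$ implies $n_1=n_2$; (2) $\langle p,x,n\rangle\in E$ implies $\langle p',x',n\rangle\in E$ for all prolongations $p'$ of $p$ and $x'$ of $x$ (equality allowed); (3) if $\langle p,x',n\rangle,\langle p',x,n\rangle\in E$, $p$ is a prefix of $p'$ and $x$ is a prefix of $x'$, then $\langle p,x,n\rangle\in E$. Put $C_E(n|x)=\min\{\ell(p)\mid\langle p,x,n\rangle\in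 E\}$, and $K_*(n|x*)=C_E(n|x)$ for a $K_*$-correct $E$ that is optimal, i.e. for every $K_*$-correct $E'$ there is a constant $c'$ with $C_E(n|x)\le C_{E'}(n|x)+c'$ for all $n,x$. Theorem. With either definition of $K_*$ there is a constant $c$ such that for every computable measure $\mu$, every code $T$ of $\mu$ (i.e. $\nu_T=\mu$) and all strings $x,y\in\mathcal X^*$, writing $K_*(\mu|x*)=K_*(T|x*)$, $$\log_2\frac{\mu(y|x)}{M(y|x)}\;\le\;K_*(\mu|x*)+K(\lceil d_\mu(x)\rceil)+c .$$ The constant $c$ depends only on the alphabet, the fixed optimal objects and the enumeration, not on $\mu,T,x,y$. -/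

import Mathlib

open scoped ENNReal BigOperators

namespace AIT

/-! ### Logarithms and powers with values in the extended reals -/

/-- The binary logarithm `[0, ∞] → [-∞, ∞]`, with `log₂ 0 = -∞` and `log₂ ∞ = ∞`. -/
noncomputable def log2 (a : ℝ≥0∞) : EReal :=
  ENNReal.log a / ((Real.log 2 : ℝ) : EReal)

/-- The embedding of `ℕ ∪ {∞}` (code lengths) into the extended reals. -/
noncomputable def lenToEReal (k : ℕ∞) : EReal :=
  (((k : ℝ≥0∞)) : EReal)

/-- The weight `2 ^ (-k)` of a code length `k`, with `2 ^ (-∞) = 0`. -/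
noncomputable def twoPowNeg (k : ℕ∞) : ℝ≥0∞ :=
  ENat.recTopCoe (C := fun _ => ℝ≥0∞) 0 (fun n => (2⁻¹ : ℝ≥0∞) ^ n) k

/-! ### Prefix complexity -/

/-- A prefix machine: a partial computable map from binary programs to natural numbers (which
serve as codes of the finite objects) whose domain is prefix free. -/
structure PrefixMachine where
  run : List Bool →. ℕ
  partrec : Partrec run
  prefixFree : ∀ p q : List Bool, (run p).Dom → (run q).Dom → p <+: q → p = q

namespace PrefixMachine

/-- `K_T(n)`: the least length of a program of `T` with output `n` (`∞` if there is none). -/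
noncomputable def K (T : PrefixMachine) (n : ℕ) : ℕ∞ :=
  ⨅ (p : List Bool) (_ : n ∈ T.run p), (p.length : ℕ∞)

/-- `U` is an optimal (additively universal) prefix machine. -/
def IsOptimal (U : PrefixMachine) : Prop :=
  ∀ T : PrefixMachine, ∃ c : ℕ, ∀ n : ℕ, U.K n ≤ T.K n + c

/-- Prefix complexity of an integer, through the standard bijective code `ℤ ≃ ℕ`. -/
noncomputable def KInt (U : PrefixMachine) (z : ℤ) : ℕ∞ :=
  U.K (Equiv.intEquivNat z)

open Classical in
/-- `K(⌈d⌉)` for an extended real `d`, with `K(⌈d⌉) = ∞` if `d` is infinite. -/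
noncomputable def KCeil (U : PrefixMachine) (d : EReal) : ℕ∞ :=
  if d = ⊤ ∨ d = ⊥ then ⊤ else U.KInt ⌈d.toReal⌉

end PrefixMachine

/-! ### Semimeasures, measures, enumerability -/

/-- A semimeasure on strings: `ρ(ε) ≤ 1` and `∑ₐ ρ(xa) ≤ ρ(x)`. -/
def IsSemimeasure {X : Type*} [Fintype X] (ρ : List X → ℝ≥0∞) : Prop :=
  ρ [] ≤ 1 ∧ ∀ x : List X, ∑ a : X, ρ (x ++ [a]) ≤ ρ x

/-- A (probability) measure on strings: `ρ(ε) = 1` and `∑ₐ ρ(xa) = ρ(x)`. -/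
def IsStringMeasure {X : Type*} [Fintype X] (ρ : List X → ℝ≥0∞) : Prop :=
  ρ [] = 1 ∧ ∀ x : List X, ∑ a : X, ρ (x ++ [a]) = ρ x

/-- The nonnegative rational number `k / (n + 1)`. -/
noncomputable def frac (k n : ℕ) : ℝ≥0∞ := (k : ℝ≥0∞) / ((n : ℝ≥0∞) + 1)

/-- `f` is enumerable: the set of pairs `(x, q)` with `q` rational and `q < f x` is recursively
enumerable (for nonnegative `f` only `q ≥ 0` matters). -/
def EnumerableFun {X : Type*} [Primcodable X] (f : List X → ℝ≥0∞) : Prop :=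
  REPred fun a : List X × ℕ × ℕ => frac a.2.1 a.2.2 < f a.1

/-- `f` is co-enumerable: the set of pairs `(x, q)` with `q` rational and `f x < q` is recursively
enumerable. -/
def CoEnumerableFun {X : Type*} [Primcodable X] (f : List X → ℝ≥0∞) : Prop :=
  REPred fun a : List X × ℕ × ℕ => f a.1 < frac a.2.1 a.2.2

/-- A computable measure: enumerable, co-enumerable, with a decidable set of zeros. -/
def IsComputableMeasure {X : Type*} [Fintype X] [Primcodable X] (μ : List X → ℝ≥0∞) : Prop :=
  IsStringMeasure μ ∧ EnumerableFun μ ∧ CoEnumerableFun μ ∧ ComputablePred fun x => μ x = 0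

/-- `κ x y` is a version of the conditional probability `μ(y|x)`: it is `μ(xy) / μ(x)` whenever
`μ(x) ≠ 0`, and arbitrary otherwise. -/
def IsCondVersion {X : Type*} (μ : List X → ℝ≥0∞) (κ : List X → List X → ℝ≥0∞) : Prop :=
  ∀ x y : List X, μ x ≠ 0 → κ x y = μ (x ++ y) / μ x

/-- `(ν T)` is an effective enumeration of all enumerable semimeasures: every `ν T` is a
semimeasure, the `ν T` are enumerable uniformly in `T`, and every enumerable semimeasure occurs. -/
def IsEffectiveEnumeration {X : Type*} [Fintype X] [Primcodable X]
    (ν : ℕ → List X → ℝ≥0∞) : Prop :=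
  (∀ T, IsSemimeasure (ν T)) ∧
  (REPred fun a : ℕ × List X × ℕ × ℕ => frac a.2.2.1 a.2.2.2 < ν a.1 a.2.1) ∧
  (∀ ρ : List X → ℝ≥0∞, IsSemimeasure ρ → EnumerableFun ρ → ∃ T, ν T = ρ)

/-! ### Solomonoff's prior and the randomness deficiency -/

/-- Solomonoff's prior `M(x) = ∑_T 2^{-K(T)} ν_T(x)`. -/
noncomputable def solomonoff {X : Type*} (U : PrefixMachine) (ν : ℕ → List X → ℝ≥0∞)
    (x : List X) : ℝ≥0∞ :=
  ∑' T : ℕ, twoPowNeg (U.K T) * ν T x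

/-- The conditional value `ρ(y|x) = ρ(xy) / ρ(x)`. -/
noncomputable def condVal {X : Type*} (ρ : List X → ℝ≥0∞) (x y : List X) : ℝ≥0∞ :=
  ρ (x ++ y) / ρ x

/-- The randomness deficiency `d_μ(x) = log₂ (M(x) / μ(x))`; it is `∞` if `μ(x) = 0 < M(x)`. -/
noncomputable def deficiency {X : Type*} (M μ : List X → ℝ≥0∞) (x : List X) : EReal :=
  log2 (M x / μ x)

/-! ### Twice prefix machines -/

/-- What a machine with two one-way input tapes without delimiters does next: it reads one more
symbol from the first (program) tape, or one more symbol from the second (condition) tape, or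
halts with an output. -/
abbrev TapeAction := Bool ⊕ ℕ

/-- Read the next bit of the first tape. -/
abbrev TapeAction.readProgram : TapeAction := Sum.inl false

/-- Read the next symbol of the second tape. -/
abbrev TapeAction.readCondition : TapeAction := Sum.inl true

/-- Halt and print `n`. -/
abbrev TapeAction.halt (n : ℕ) : TapeAction := Sum.inr n

/-- A twice prefix machine. Since the machine is deterministic and sees nothing of its tapes but
the parts `p` and `x` read so far, it is given by the partial computable function that maps
`(p, x)` to its next reading or halting action, undefined if the machine then computes
forever without reading or halting. -/
structure TwicePrefixMachine (X : Type*) [Primcodable X] where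
  next : List Bool × List X →. TapeAction
  partrec : Partrec next

namespace TwicePrefixMachine

variable {X : Type*} [Primcodable X]

/-- `T.Reads p x`: on a first tape beginning with `p` and a second tape beginning with `x`, at
some moment of the computation the machine has read exactly `p` and `x`. -/
inductive Reads (T : TwicePrefixMachine X) : List Bool → List X → Prop
  | start : Reads T [] []
  | program (p : List Bool) (x : List X) (b : Bool) :
      Reads T p x → TapeAction.readProgram ∈ T.next (p, x) → Reads T (p ++ [b]) x
  | condition (p : List Bool) (x : List X) (a : X) :
      Reads T p x → TapeAction.readCondition ∈ T.next (p, x) → Reads T p (x ++ [a])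

/-- `T(p, x) = n`: the machine halts after reading exactly `p` and `x`, and prints `n`. -/
def Outputs (T : TwicePrefixMachine X) (p : List Bool) (x : List X) (n : ℕ) : Prop :=
  T.Reads p x ∧ TapeAction.halt n ∈ T.next (p, x)

/-- `C_T(n|x) = min {l(p) | ∃ k ≤ l(x), T(p, x₁…xₖ) = n}` (`∞` if there is no such `p`). -/
noncomputable def C (T : TwicePrefixMachine X) (n : ℕ) (x : List X) : ℕ∞ :=
  ⨅ (p : List Bool) (_ : ∃ k ≤ x.length, T.Outputs p (x.take k) n), (p.length : ℕ∞)

/-- Optimality among twice prefix machines; for optimal `U` the value `U.C n x` is `K_*(n|x*)`. -/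
def IsOptimal (U : TwicePrefixMachine X) : Prop :=
  ∀ T : TwicePrefixMachine X, ∃ c : ℕ, ∀ (n : ℕ) (x : List X), U.C n x ≤ T.C n x + c

end TwicePrefixMachine

/-! ### `K_*`-correct sets -/

/-- `K_*`-correct sets of triples `(p, x, n)`. -/
structure IsKStarCorrect {X : Type*} [Primcodable X] (E : Set (List Bool × List X × ℕ)) :
    Prop where
  enumerable : REPred fun t : List Bool × List X × ℕ => t ∈ E
  functional : ∀ (p : List Bool) (x : List X) (m n : ℕ), (p, x, m) ∈ E → (p, x, n) ∈ E → m = n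
  prolong : ∀ (p p' : List Bool) (x x' : List X) (n : ℕ),
    (p, x, n) ∈ E → p <+: p' → x <+: x' → (p', x', n) ∈ E
  meet : ∀ (p p' : List Bool) (x x' : List X) (n : ℕ),
    (p, x', n) ∈ E → (p', x, n) ∈ E → p <+: p' → x <+: x' → (p, x, n) ∈ E

/-- `C_E(n|x) = min {l(p) | (p, x, n) ∈ E}` (`∞` if there is no such `p`). -/
noncomputable def setComplexity {X : Type*} (E : Set (List Bool × List X × ℕ)) (n : ℕ)
    (x : List X) : ℕ∞ :=
  ⨅ (p : List Bool) (_ : (p, x, n) ∈ E), (p.length : ℕ∞)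

/-- `E` is an optimal `K_*`-correct set; then `setComplexity E n x` is `K_*(n|x*)`. -/
def IsOptimalKStarCorrect {X : Type*} [Primcodable X] (E : Set (List Bool × List X × ℕ)) :
    Prop :=
  IsKStarCorrect E ∧ ∀ E' : Set (List Bool × List X × ℕ), IsKStarCorrect E' →
    ∃ c : ℕ, ∀ (n : ℕ) (x : List X), setComplexity E n x ≤ setComplexity E' n x + c

/-- `Kstar n x` is the complexity `K_*(n|x*)` monotone in its condition, in one of its two
definitions: through an optimal twice prefix machine or through an optimal `K_*`-correct set. -/
def IsKStar {X : Type*} [Primcodable X] (Kstar : ℕ → List X → ℕ∞) : Prop :=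
  (∃ V : TwicePrefixMachine X, V.IsOptimal ∧ Kstar = V.C) ∨
  (∃ E : Set (List Bool × List X × ℕ), IsOptimalKStarCorrect E ∧ Kstar = setComplexity E)

end AIT

/-!
Let `M` be Solomonoff's prior, let `x` have deficiency `d = ⌈d_μ(x)⌉`, and let `p` be a program from
which `x` determines a code `T` of `μ`. Since `2 ^ (d - 1) μ(x) < M(x) ≤ 2 ^ d μ(x)`, the bound on
`μ(y|x) / M(y|x)` amounts to `M(xy) ≥ 2 ^ (-K_*(T|x*) - K(d) - c) 2 ^ (d - 1) μ(xy)`, and as `M`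
dominates every enumerable semimeasure, it is enough to find one enumerable semimeasure `ρ` with this
property.

Fix an infinite binary tape `ω`. Whenever `ω` begins with a self-delimiting program for some `d`,
followed by a program that outputs `T` on `x`, and `2 ^ (d - 1) ν_T(x) < M(x)`, give to every
prolongation `xy` the weight `2 ^ (d - 1) ν_T(xy)`. On a path of prolongations of `x` the label
`(T, d)` cannot change, so the first points that pass the test form an antichain on which the weights
are at most `M`, and their total is at most `M(ε) ≤ 1`. The semimeasure `ρ` is the average over `ω`;
a pair of programs of total length `n` occupies the fraction `2 ^ (-n)` of the tapes.

Three points make `ρ` an enumerable semimeasure. The test is enumerable because `ν_T(x)` is bounded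
from above by one minus the values at the other strings of the same length (`Exceeds`), exactly so if
`ν_T` is a measure; for the other `T` only the inequality is needed. Being first to pass an
enumerable test is not enumerable, so a string `z` is stopped only once a passed test among its
prefixes is confirmed within `z.length` steps, which is decidable; the weight generated by the
stopped strings (`hitSum`) is compared with `M` through the superadditive function
`TestSystem.majorant`, and for a measure `ν_T` no weight is lost by the delay (`le_hitSum`). Finally
the average is the supremum over `N` of averages over tapes of length `N`, which increase with `N`
(`TestSystem.average_mono`).

The construction uses of `K_*` only that it minimizes program lengths over an enumerable set of
triples that is functional and closed under prolongation. A twice prefix machine yields such a set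
through prolongation of its halting inputs (`IsKStar.exists_enumerable`), so both definitions are
treated alike. Enumerability is handled as lower semicomputability (`LSC`), which is closed under
sums, products, suprema and series.
-/

namespace AIT

open Encodable

/-! ### Recursively enumerable predicates -/

section REPred

variable {α β : Type*} [Primcodable α] [Primcodable β]

theorem rePred_comp {p : β → Prop} (hp : REPred p) {f : α → β} (hf : Computable f) :
    REPred fun a => p (f a) :=
  Partrec.comp hp hf

/-- A recursively enumerable predicate is the union of an increasing, primitive recursive sequence
of decidable approximations: run a program for it for `n` steps. -/
theorem exists_primrec_stage {p : α → Prop} (hp : REPred p) :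
    ∃ f : α → ℕ → Prop, PrimrecRel f ∧ (∀ a m n, m ≤ n → f a m → f a n) ∧
      ∀ a, p a ↔ ∃ n, f a n := by
  obtain ⟨c, hc⟩ := Nat.Partrec.Code.exists_code.1 (show Nat.Partrec _ from hp)
  refine ⟨fun a n => (Nat.Partrec.Code.evaln n c (encode a)).isSome = true, ?_, ?_, ?_⟩
  · refine Primrec.eq.comp (Primrec.option_isSome.comp
      (Nat.Partrec.Code.primrec_evaln.comp (.pair (.pair .snd (.const c))
        (Primrec.encode.comp .fst)))) (.const true)
  · intro a m n hmn h
    obtain ⟨y, hy⟩ := Option.isSome_iff_exists.1 h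
    exact Option.isSome_iff_exists.2 ⟨y, Nat.Partrec.Code.evaln_mono hmn hy⟩
  · intro a
    have h1 : p a ↔ (Nat.Partrec.Code.eval c (encode a)).Dom := by
      rw [hc]
      simp [Part.assert]
    rw [h1, Part.dom_iff_mem]
    simp only [Nat.Partrec.Code.evaln_complete, Option.isSome_iff_exists, Option.mem_def]
    exact exists_comm

theorem rePred_of_exists_nat {p : α → ℕ → Prop} (hp : PrimrecRel p) :
    REPred fun a => ∃ n, p a n := by
  classical
  have h : Partrec fun a => Nat.rfind fun n => Part.some (decide (p a n)) :=
    Partrec.rfind (Computable.partrec (Primrec.to_comp (PrimrecPred.decide hp)))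
  refine h.dom_re.of_eq fun a => ?_
  refine Nat.rfind_dom'.trans ?_
  simp

theorem rePred_of_primrecPred {p : α → Prop} (hp : PrimrecPred p) : REPred p :=
  ComputablePred.to_re hp.computablePred

theorem rePred_and {p q : α → Prop} (hp : REPred p) (hq : REPred q) :
    REPred fun a => p a ∧ q a := by
  obtain ⟨f, hf, fm, hpf⟩ := exists_primrec_stage hp
  obtain ⟨g, hg, gm, hqg⟩ := exists_primrec_stage hq
  refine (rePred_of_exists_nat (p := fun a n => f a n ∧ g a n) (PrimrecPred.and hf hg)).of_eq ?_
  intro a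
  rw [hpf, hqg]
  constructor
  · rintro ⟨n, h1, h2⟩
    exact ⟨⟨n, h1⟩, n, h2⟩
  · rintro ⟨⟨m, h1⟩, n, h2⟩
    exact ⟨max m n, fm _ _ _ (le_max_left _ _) h1, gm _ _ _ (le_max_right _ _) h2⟩

theorem rePred_exists {p : α → β → Prop} (hp : REPred fun a : α × β => p a.1 a.2) :
    REPred fun a => ∃ b, p a b := by
  classical
  obtain ⟨f, hf, fm, hpf⟩ := exists_primrec_stage hp
  have hf' : Primrec fun q : (α × β) × ℕ => decide (f q.1 q.2) := PrimrecPred.decide hf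
  let g : α → ℕ → Bool := fun a n =>
    ((decode (α := β × ℕ) n).map fun c => decide (f (a, c.1) c.2)).getD false
  have hg : Primrec₂ g := by
    refine Primrec.option_getD.comp (Primrec.option_map (Primrec.decode.comp .snd) ?_) (.const false)
    have hk : Primrec fun q : (α × ℕ) × (β × ℕ) => ((q.1.1, q.2.1), q.2.2) :=
      Primrec.pair (Primrec.pair (Primrec.fst.comp .fst) (Primrec.fst.comp .snd))
        (Primrec.snd.comp .snd)
    exact hf'.comp hk
  refine (rePred_of_exists_nat (p := fun a n => g a n = true)
    (Primrec.eq.comp hg (.const true))).of_eq ?_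
  intro a
  constructor
  · rintro ⟨n, hn⟩
    dsimp only [g] at hn
    generalize decode (α := β × ℕ) n = o at hn
    cases o with
    | none => simp at hn
    | some c => exact ⟨c.1, (hpf (a, c.1)).2 ⟨c.2, by simpa using hn⟩⟩
  · rintro ⟨b, hb⟩
    obtain ⟨n, hn⟩ := (hpf (a, b)).1 hb
    exact ⟨encode (b, n), by simpa [g] using hn⟩

theorem rePred_mem_of_partrec {σ : Type*} [Primcodable σ] {f : α →. σ} (hf : Partrec f) :
    REPred fun a : α × σ => a.2 ∈ f a.1 := by
  classical
  have h : Partrec fun a : α × σ => (f a.1).bind fun s =>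
      cond (decide (encode s = encode a.2)) (Part.some ()) Part.none := by
    refine Partrec.bind (hf.comp .fst) ?_
    refine Partrec.cond (Primrec.to_comp ?_) (.const' _) .none
    exact PrimrecPred.decide (Primrec.eq.comp (Primrec.encode.comp .snd)
      (Primrec.encode.comp (Primrec.snd.comp .fst)))
  refine h.dom_re.of_eq fun a => ?_
  simp only [Part.bind_dom, encode_inj]
  constructor
  · rintro ⟨h1, h2⟩
    by_cases h3 : (f a.1).get h1 = a.2
    · exact h3 ▸ Part.get_mem h1
    · simp [h3] at h2
  · intro h
    obtain ⟨h1, h2⟩ := h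
    exact ⟨h1, by simp [h2]⟩

end REPred

/-! ### Lower semicomputable functions -/

section LSC

variable {α β : Type*} [Primcodable α] [Primcodable β]

/-- `f` is lower semicomputable: the supremum of a primitive recursive sequence of fractions. -/
def LSC (f : α → ℝ≥0∞) : Prop :=
  ∃ g : α → ℕ → ℕ × ℕ, Primrec₂ g ∧ ∀ a, f a = ⨆ i, frac (g a i).1 (g a i).2

theorem LSC.of_eq {f g : α → ℝ≥0∞} (hf : LSC f) (h : ∀ a, f a = g a) : LSC g :=
  (funext h : f = g) ▸ hf

theorem frac_zero (n : ℕ) : frac 0 n = 0 := by simp [frac]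

theorem frac_lt_frac_iff (k n l m : ℕ) : frac k n < frac l m ↔ k * (m + 1) < l * (n + 1) := by
  unfold frac
  rw [ENNReal.div_lt_iff (by simp) (by simp), mul_comm, mul_div_assoc',
    ENNReal.lt_div_iff_mul_lt (by simp) (by simp)]
  rw [mul_comm ((n : ℝ≥0∞) + 1)]
  exact_mod_cast Iff.rfl

theorem frac_mul_frac (k n l m : ℕ) :
    frac k n * frac l m = frac (k * l) ((n + 1) * (m + 1) - 1) := by
  have h : (((n + 1) * (m + 1) - 1 : ℕ) : ℝ≥0∞) + 1 = ((n : ℝ≥0∞) + 1) * (m + 1) := by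
    have : ((n + 1) * (m + 1) - 1) + 1 = (n + 1) * (m + 1) :=
      Nat.sub_add_cancel (Nat.mul_pos (by simp) (by simp))
    exact_mod_cast this
  unfold frac
  rw [h, Nat.cast_mul, div_eq_mul_inv, div_eq_mul_inv, div_eq_mul_inv,
    ENNReal.mul_inv (by simp) (by simp)]
  ring

theorem frac_add_frac (k n l m : ℕ) :
    frac k n + frac l m = frac (k * (m + 1) + l * (n + 1)) ((n + 1) * (m + 1) - 1) := by
  have h1 : frac k n = frac (k * (m + 1)) ((n + 1) * (m + 1) - 1) := by
    rw [← frac_mul_frac]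
    simp [frac, ENNReal.div_self]
  have h2 : frac l m = frac (l * (n + 1)) ((n + 1) * (m + 1) - 1) := by
    rw [mul_comm (n + 1), ← frac_mul_frac]
    simp [frac, ENNReal.div_self]
  rw [h1, h2]
  simp [frac, ENNReal.add_div]

theorem exists_frac_btwn {a b : ℝ≥0∞} (h : a < b) : ∃ k n, a < frac k n ∧ frac k n < b := by
  obtain ⟨q, hq0, h1, h2⟩ := ENNReal.lt_iff_exists_rat_btwn.1 h
  have : ((q : ℝ).toNNReal : ℝ≥0∞) = frac q.num.toNat (q.den - 1) := by
    unfold frac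
    have hd : ((q.den - 1 : ℕ) : ℝ≥0∞) + 1 = (q.den : ℝ≥0∞) := by
      exact_mod_cast Nat.sub_add_cancel q.den_pos
    rw [hd, ENNReal.eq_div_iff (by simp) (by simp)]
    have : (q.den : NNReal) * (q : ℝ).toNNReal = (q.num.toNat : NNReal) := by
      apply NNReal.coe_injective
      have hn : ((q.num.toNat : ℕ) : ℤ) = q.num := Int.toNat_of_nonneg (Rat.num_nonneg.2 hq0)
      have hn' : ((q.num.toNat : ℕ) : ℝ) = (q.num : ℝ) := by exact_mod_cast hn
      push_cast
      rw [Real.coe_toNNReal _ (by exact_mod_cast hq0), hn']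
      have := Rat.den_mul_eq_num q
      exact_mod_cast this
    exact_mod_cast this
  exact ⟨_, _, this ▸ h1, this ▸ h2⟩

/-- Lower semicomputability from a primitive recursive family of fractions that is indexed by an
arbitrary type with a primitive recursive coding. -/
theorem LSC.of_iSup_frac {f : α → ℝ≥0∞} {h : α → β → ℕ × ℕ} (hh : Primrec₂ h)
    (hf : ∀ a, f a = ⨆ b, frac (h a b).1 (h a b).2) : LSC f := by
  refine ⟨fun a n => ((decode (α := β) n).map fun b => h a b).getD (0, 0), ?_, fun a => ?_⟩
  · exact Primrec.option_getD.comp (Primrec.option_map (Primrec.decode.comp .snd)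
      (hh.comp (Primrec.fst.comp .fst) .snd)) (.const _)
  · rw [hf]
    apply le_antisymm
    · refine iSup_le fun b => le_iSup_of_le (encode b) ?_
      simp
    · refine iSup_le fun n => ?_
      dsimp only
      generalize decode (α := β) n = o
      cases o with
      | none => simp [frac_zero]
      | some b => simpa using le_iSup (fun b => frac (h a b).1 (h a b).2) b

theorem LSC.comp {f : β → ℝ≥0∞} (hf : LSC f) {k : α → β} (hk : Primrec k) :
    LSC fun a => f (k a) := by
  obtain ⟨g, hg, h⟩ := hf
  exact ⟨fun a i => g (k a) i, hg.comp (hk.comp .fst) .snd, fun a => h (k a)⟩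

theorem LSC.frac {k n : α → ℕ} (hk : Primrec k) (hn : Primrec n) :
    LSC fun a => frac (k a) (n a) :=
  ⟨fun a _ => (k a, n a), Primrec.pair (hk.comp .fst) (hn.comp .fst), fun a => by simp⟩

theorem LSC.iSup {f : α → β → ℝ≥0∞} (hf : LSC fun a : α × β => f a.1 a.2) :
    LSC fun a => ⨆ b, f a b := by
  obtain ⟨g, hg, h⟩ := hf
  refine LSC.of_iSup_frac (β := β × ℕ) (h := fun a c => g (a, c.1) c.2)
    (hg.comp (.pair .fst (Primrec.fst.comp .snd)) (Primrec.snd.comp .snd)) fun a => ?_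
  rw [iSup_prod]
  exact iSup_congr fun b => h (a, b)

theorem LSC.mul {f g : α → ℝ≥0∞} (hf : LSC f) (hg : LSC g) : LSC fun a => f a * g a := by
  obtain ⟨u, hu, hu'⟩ := hf
  obtain ⟨v, hv, hv'⟩ := hg
  refine LSC.of_iSup_frac (β := ℕ × ℕ) (h := fun a c => ((u a c.1).1 * (v a c.2).1,
    ((u a c.1).2 + 1) * ((v a c.2).2 + 1) - 1)) ?_ fun a => ?_
  · have h1 : Primrec fun p : α × (ℕ × ℕ) => u p.1 p.2.1 := hu.comp .fst (Primrec.fst.comp .snd)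
    have h2 : Primrec fun p : α × (ℕ × ℕ) => v p.1 p.2.2 := hv.comp .fst (Primrec.snd.comp .snd)
    exact Primrec.pair (Primrec.nat_mul.comp (Primrec.fst.comp h1) (Primrec.fst.comp h2))
      (Primrec.pred.comp (Primrec.nat_mul.comp (Primrec.succ.comp (Primrec.snd.comp h1))
        (Primrec.succ.comp (Primrec.snd.comp h2))))
  · rw [hu', hv', iSup_prod, ENNReal.iSup_mul]
    refine iSup_congr fun i => ?_
    rw [ENNReal.mul_iSup]
    exact iSup_congr fun j => frac_mul_frac _ _ _ _

/-- Addition of pairs `(k, n)` that stand for the fractions `k / (n + 1)`. -/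
def addPair (a b : ℕ × ℕ) : ℕ × ℕ :=
  (a.1 * (b.2 + 1) + b.1 * (a.2 + 1), (a.2 + 1) * (b.2 + 1) - 1)

theorem frac_addPair (a b : ℕ × ℕ) :
    AIT.frac (addPair a b).1 (addPair a b).2 = AIT.frac a.1 a.2 + AIT.frac b.1 b.2 :=
  (frac_add_frac _ _ _ _).symm

theorem primrec_addPair : Primrec₂ addPair := by
  have h1 : Primrec fun p : (ℕ × ℕ) × (ℕ × ℕ) => p.1.1 := Primrec.fst.comp .fst
  have h2 : Primrec fun p : (ℕ × ℕ) × (ℕ × ℕ) => p.1.2 + 1 :=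
    Primrec.succ.comp (Primrec.snd.comp .fst)
  have h3 : Primrec fun p : (ℕ × ℕ) × (ℕ × ℕ) => p.2.1 := Primrec.fst.comp .snd
  have h4 : Primrec fun p : (ℕ × ℕ) × (ℕ × ℕ) => p.2.2 + 1 :=
    Primrec.succ.comp (Primrec.snd.comp .snd)
  exact Primrec.pair (Primrec.nat_add.comp (Primrec.nat_mul.comp h1 h4) (Primrec.nat_mul.comp h3 h2))
    (Primrec.pred.comp (Primrec.nat_mul.comp h2 h4))

theorem LSC.add {f g : α → ℝ≥0∞} (hf : LSC f) (hg : LSC g) : LSC fun a => f a + g a := by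
  obtain ⟨u, hu, hu'⟩ := hf
  obtain ⟨v, hv, hv'⟩ := hg
  refine LSC.of_iSup_frac (β := ℕ × ℕ) (h := fun a c => addPair (u a c.1) (v a c.2)) ?_ fun a => ?_
  · exact primrec_addPair.comp (hu.comp .fst (Primrec.fst.comp .snd))
      (hv.comp .fst (Primrec.snd.comp .snd))
  · rw [hu', hv', iSup_prod, ENNReal.iSup_add]
    refine iSup_congr fun i => ?_
    rw [ENNReal.add_iSup]
    exact iSup_congr fun j => (frac_addPair _ _).symm

open Classical in
/-- The indicator of a proposition. -/
noncomputable def ind (p : Prop) : ℝ≥0∞ := if p then 1 else 0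

theorem ind_true {p : Prop} (h : p) : ind p = 1 := by simp [ind, h]

theorem ind_false {p : Prop} (h : ¬p) : ind p = 0 := by simp [ind, h]

theorem ind_mono {p q : Prop} (h : p → q) : ind p ≤ ind q := by
  by_cases hp : p
  · rw [ind_true hp, ind_true (h hp)]
  · simp [ind_false hp]

theorem LSC.ind {p : α → Prop} (hp : REPred p) : LSC fun a => ind (p a) := by
  classical
  obtain ⟨f, hf, -, hpf⟩ := exists_primrec_stage hp
  refine ⟨fun a n => (if f a n then 1 else 0, 0),
    Primrec.pair (Primrec.ite hf (.const 1) (.const 0)) (.const 0), fun a => ?_⟩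
  dsimp only
  by_cases h : p a
  · obtain ⟨n, hn⟩ := (hpf a).1 h
    rw [ind_true h]
    apply le_antisymm
    · exact le_iSup_of_le n (by simp [hn, AIT.frac])
    · refine iSup_le fun m => ?_
      by_cases hm : f a m <;> simp [hm, AIT.frac]
  · have : ∀ n, ¬ f a n := fun n hn => h ((hpf a).2 ⟨n, hn⟩)
    simp [ind_false h, this, AIT.frac]

/-- A lower semicomputable function is enumerable. -/
theorem LSC.rePred_frac_lt {f : α → ℝ≥0∞} (hf : LSC f) :
    REPred fun a : α × ℕ × ℕ => AIT.frac a.2.1 a.2.2 < f a.1 := by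
  obtain ⟨g, hg, h⟩ := hf
  have hp : PrimrecRel fun (a : α × ℕ × ℕ) (i : ℕ) =>
      a.2.1 * ((g a.1 i).2 + 1) < (g a.1 i).1 * (a.2.2 + 1) := by
    have h1 : Primrec fun p : (α × ℕ × ℕ) × ℕ => g p.1.1 p.2 :=
      hg.comp (Primrec.fst.comp .fst) .snd
    have h2 : Primrec fun p : (α × ℕ × ℕ) × ℕ => p.1.2 := Primrec.snd.comp .fst
    exact Primrec.nat_lt.comp
      (Primrec.nat_mul.comp (Primrec.fst.comp h2) (Primrec.succ.comp (Primrec.snd.comp h1)))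
      (Primrec.nat_mul.comp (Primrec.fst.comp h1) (Primrec.succ.comp (Primrec.snd.comp h2)))
  refine (rePred_of_exists_nat hp).of_eq fun a => ?_
  rw [h, lt_iSup_iff]
  simp only [frac_lt_frac_iff]

/-- An enumerable function is lower semicomputable: it is the supremum of the fractions that have
been found below it. -/
theorem LSC.of_rePred_frac_lt {f : α → ℝ≥0∞}
    (hf : REPred fun a : α × ℕ × ℕ => AIT.frac a.2.1 a.2.2 < f a.1) : LSC f := by
  let u : α → ℕ × ℕ → ℝ≥0∞ := fun a c => AIT.ind (AIT.frac c.1 c.2 < f a) * AIT.frac c.1 c.2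
  have h1 : LSC fun a : α × ℕ × ℕ => AIT.frac a.2.1 a.2.2 :=
    LSC.frac (Primrec.fst.comp .snd) (Primrec.snd.comp .snd)
  have h2 : LSC fun a : α × ℕ × ℕ => u a.1 a.2 := (LSC.ind hf).mul h1
  refine h2.iSup.of_eq fun a => ?_
  apply le_antisymm
  · refine iSup_le fun c => ?_
    by_cases hc : AIT.frac c.1 c.2 < f a
    · simp only [u]
      rw [ind_true hc, one_mul]
      exact hc.le
    · simp only [u]
      rw [ind_false hc, zero_mul]
      exact zero_le
  · refine le_of_forall_lt fun b hb => ?_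
    obtain ⟨k, n, h1, h2⟩ := exists_frac_btwn hb
    refine h1.trans_le (le_iSup_of_le (k, n) ?_)
    simp only [u]
    rw [ind_true h2, one_mul]

/-- `fracSum g [j, …]` adds the fractions `g i jᵢ`, where the entries of the list are numbered from
its end: a finite sum in which every summand is replaced by one of its approximations. -/
def fracSum (g : ℕ → ℕ → ℕ × ℕ) : List ℕ → ℕ × ℕ
  | [] => (0, 0)
  | j :: l => addPair (g l.length j) (fracSum g l)

/-- A series of suprema is the supremum of the finite sums in which every summand is replaced by
one of its approximations, and those sums are coded by lists. -/
theorem LSC.tsum_nat {f : α → ℕ → ℝ≥0∞} (hf : LSC fun a : α × ℕ => f a.1 a.2) :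
    LSC fun a => ∑' n, f a n := by
  obtain ⟨g, hg, h⟩ := hf
  let G : α → ℕ → ℕ → ℕ × ℕ := fun a i j => g (a, i) j
  have hfG : ∀ a n, f a n = ⨆ j, AIT.frac (G a n j).1 (G a n j).2 := fun a n => h (a, n)
  refine LSC.of_iSup_frac (β := List ℕ) (h := fun a l => fracSum (G a) l) ?_ fun a => ?_
  · have : Primrec₂ fun (p : α × List ℕ) (c : ℕ × List ℕ × (ℕ × ℕ)) =>
        addPair (g (p.1, c.2.1.length) c.1) c.2.2 := by
      refine primrec_addPair.comp (hg.comp (.pair (Primrec.fst.comp .fst)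
        (Primrec.list_length.comp (Primrec.fst.comp (Primrec.snd.comp .snd))))
        (Primrec.fst.comp .snd)) (Primrec.snd.comp (Primrec.snd.comp .snd))
    refine (Primrec.list_rec Primrec.snd (.const ((0, 0) : ℕ × ℕ)) this).of_eq fun p => ?_
    induction p.2 with
    | nil => rfl
    | cons j l ih => exact congrArg (addPair (g (p.1, l.length) j)) ih
  · apply le_antisymm
    · rw [ENNReal.tsum_eq_iSup_nat]
      refine iSup_le fun N => ?_
      have : ∑ i ∈ Finset.range N, f a i ≤
          ⨆ l : {l : List ℕ // l.length = N},
            AIT.frac (fracSum (G a) l.1).1 (fracSum (G a) l.1).2 := by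
        induction N with
        | zero => simp
        | succ N ih =>
          rw [Finset.sum_range_succ, hfG a N]
          refine (add_le_add_left ih _).trans ?_
          have : Nonempty {l : List ℕ // l.length = N} := ⟨⟨List.replicate N 0, by simp⟩⟩
          rw [ENNReal.iSup_add]
          refine iSup_le fun l => ?_
          rw [ENNReal.add_iSup]
          refine iSup_le fun j => le_iSup_of_le ⟨j :: l.1, by simp [l.2]⟩ ?_
          simp only [fracSum, frac_addPair, l.2]
          rw [add_comm]
      exact this.trans (iSup_le fun l => le_iSup
        (fun l => AIT.frac (fracSum (G a) l).1 (fracSum (G a) l).2) l.1)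
    · refine iSup_le fun l => ?_
      refine le_trans ?_ (ENNReal.sum_le_tsum (Finset.range l.length))
      induction l with
      | nil => simp [fracSum, frac_zero]
      | cons j l ih =>
        simp only [fracSum, frac_addPair]
        rw [List.length_cons, Finset.sum_range_succ, add_comm]
        refine add_le_add ih ?_
        rw [hfG]
        exact le_iSup (fun j => AIT.frac (G a l.length j).1 (G a l.length j).2) j

theorem LSC.tsum {f : α → β → ℝ≥0∞} (hf : LSC fun a : α × β => f a.1 a.2) :
    LSC fun a => ∑' b, f a b := by
  obtain ⟨g, hg, h⟩ := hf
  let F : α → ℕ → ℝ≥0∞ := fun a n => ((decode₂ β n).map fun b => f a b).getD 0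
  have hF : LSC fun a : α × ℕ => F a.1 a.2 := by
    refine ⟨fun a i => ((decode₂ β a.2).map fun b => g (a.1, b) i).getD (0, 0), ?_, fun a => ?_⟩
    · exact Primrec.option_getD.comp (Primrec.option_map
        (Primrec.decode₂.comp (Primrec.snd.comp .fst))
        (hg.comp (.pair (Primrec.fst.comp (Primrec.fst.comp .fst)) .snd)
          (Primrec.snd.comp .fst))) (.const _)
    · cases hd : decode₂ β a.2 with
      | none => simp [F, hd, frac_zero]
      | some b => simpa [F, hd] using h (a.1, b)
  refine hF.tsum_nat.of_eq fun a => ?_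
  have hsupp : Function.support (F a) ⊆ Set.range (encode : β → ℕ) := by
    intro n hn
    by_contra hr
    have : decode₂ β n = none := by
      by_contra h'
      exact hr (decode₂_ne_none_iff.1 h')
    simp [F, this] at hn
  rw [← encode_injective.tsum_eq hsupp]
  simp [F]

end LSC

/-! ### Sums over strings -/

section Tree

variable {X : Type*}

theorem tsum_list_cons [Fintype X] (f : List X → ℝ≥0∞) :
    ∑' w, f w = f [] + ∑ a : X, ∑' w, f (a :: w) := by
  let e : Unit ⊕ (X × List X) ≃ List X :=
    { toFun := Sum.elim (fun _ => []) fun c => c.1 :: c.2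
      invFun := fun l => match l with
        | [] => Sum.inl ()
        | a :: w => Sum.inr (a, w)
      left_inv := by rintro (_ | ⟨a, w⟩) <;> rfl
      right_inv := by rintro (_ | ⟨a, w⟩) <;> rfl }
  rw [← e.tsum_eq, Summable.tsum_sum ENNReal.summable ENNReal.summable]
  simp [e, ENNReal.tsum_prod', tsum_fintype]

theorem tsum_list_concat [Fintype X] (f : List X → ℝ≥0∞) :
    ∑' w, f w = f [] + ∑' w, ∑ a : X, f (w ++ [a]) := by
  rw [← (List.reverse_involutive (α := X)).toPerm.tsum_eq, tsum_list_cons,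
    ← (List.reverse_involutive (α := X)).toPerm.tsum_eq (fun w => ∑ a : X, f (w ++ [a])),
    Summable.tsum_finsetSum fun _ _ => ENNReal.summable]
  simp

/-- The sum of `f` over all strings of length `n`. -/
noncomputable def levelSum (n : ℕ) (f : List X → ℝ≥0∞) : ℝ≥0∞ :=
  ∑' w, ind (w.length = n) * f w

theorem levelSum_zero (f : List X → ℝ≥0∞) : levelSum 0 f = f [] := by
  unfold levelSum
  rw [tsum_eq_single []]
  · simp [ind]
  · intro w hw
    simp [ind, hw]

theorem levelSum_succ [Fintype X] (n : ℕ) (f : List X → ℝ≥0∞) :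
    levelSum (n + 1) f = levelSum n fun w => ∑ a : X, f (w ++ [a]) := by
  unfold levelSum
  rw [tsum_list_concat]
  simp [ind, Finset.mul_sum]

theorem levelSum_mono {n : ℕ} {f g : List X → ℝ≥0∞} (h : ∀ w, w.length = n → f w ≤ g w) :
    levelSum n f ≤ levelSum n g := by
  refine ENNReal.tsum_le_tsum fun w => ?_
  by_cases hw : w.length = n
  · exact mul_le_mul_right (h w hw) _
  · simp [ind_false hw]

theorem levelSum_const [Fintype X] (n : ℕ) (c : ℝ≥0∞) :
    levelSum (X := X) n (fun _ => c) = (Fintype.card X : ℝ≥0∞) ^ n * c := by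
  induction n generalizing c with
  | zero => simp [levelSum_zero]
  | succ n ih => simp [levelSum_succ, ih, pow_succ, mul_assoc]

theorem le_levelSum (f : List X → ℝ≥0∞) (w : List X) : f w ≤ levelSum w.length f := by
  refine le_trans ?_ (ENNReal.le_tsum w)
  simp [ind]

theorem levelSum_le_of_superadditive [Fintype X] {f : List X → ℝ≥0∞}
    (hf : ∀ x, ∑ a : X, f (x ++ [a]) ≤ f x) (n : ℕ) : levelSum n f ≤ f [] := by
  induction n with
  | zero => rw [levelSum_zero]
  | succ n ih =>
    rw [levelSum_succ]
    exact (levelSum_mono fun w _ => hf w).trans ih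

theorem levelSum_eq_of_additive [Fintype X] {f : List X → ℝ≥0∞}
    (hf : ∀ x, ∑ a : X, f (x ++ [a]) = f x) (n : ℕ) : levelSum n f = f [] := by
  induction n with
  | zero => rw [levelSum_zero]
  | succ n ih => rw [levelSum_succ, ← ih]; simp only [hf]

/-- `w` leads from `z` to a first point of `S`: `z ++ w` lies in `S`, and nothing on the way from
`z` to `z ++ w` does. -/
def FirstHit (S : List X → Prop) (z w : List X) : Prop :=
  S (z ++ w) ∧ ∀ k < w.length, ¬ S (z ++ w.take k)

/-- The total weight `φ` of the points where the set `S` is first hit, seen from `z`. -/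
noncomputable def hitSum (S : List X → Prop) (φ : List X → ℝ≥0∞) (z : List X) : ℝ≥0∞ :=
  ∑' w, ind (FirstHit S z w) * φ (z ++ w)

theorem firstHit_nil (S : List X → Prop) (z : List X) : FirstHit S z [] ↔ S z := by
  simp [FirstHit]

theorem firstHit_cons (S : List X → Prop) (z w : List X) (a : X) :
    FirstHit S z (a :: w) ↔ ¬ S z ∧ FirstHit S (z ++ [a]) w := by
  unfold FirstHit
  rw [List.length_cons]
  constructor
  · rintro ⟨h1, h2⟩
    refine ⟨by simpa using h2 0 (by simp), by simpa using h1, fun k hk => ?_⟩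
    simpa using h2 (k + 1) (by omega)
  · rintro ⟨h0, h1, h2⟩
    refine ⟨by simpa using h1, fun k hk => ?_⟩
    cases k with
    | zero => simpa using h0
    | succ k => simpa using h2 k (by omega)

theorem hitSum_of_mem [Fintype X] {S : List X → Prop} (φ : List X → ℝ≥0∞) {z : List X} (hz : S z) :
    hitSum S φ z = φ z := by
  unfold hitSum
  rw [tsum_list_cons]
  simp [firstHit_cons, firstHit_nil, hz, ind]

theorem hitSum_of_notMem [Fintype X] {S : List X → Prop} (φ : List X → ℝ≥0∞) {z : List X} (hz : ¬ S z) :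
    hitSum S φ z = ∑ a : X, hitSum S φ (z ++ [a]) := by
  unfold hitSum
  rw [tsum_list_cons]
  simp only [firstHit_cons, hz, not_false_eq_true, true_and, ind_false (mt (firstHit_nil S z).1 hz),
    zero_mul, zero_add, List.append_assoc, List.singleton_append]

/-- The first hits seen from `z` form an antichain, so a superadditive function above `φ` on `S`
bounds their total weight by its value at `z`. -/
theorem hitSum_le [Fintype X] {S : List X → Prop} {φ H : List X → ℝ≥0∞} (hS : ∀ z, S z → φ z ≤ H z)
    (hH : ∀ z, ∑ a : X, H (z ++ [a]) ≤ H z) (z : List X) : hitSum S φ z ≤ H z := by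
  have key : ∀ (n : ℕ) (z : List X),
      ∑' w, ind (w.length < n ∧ FirstHit S z w) * φ (z ++ w) ≤ H z := by
    intro n
    induction n with
    | zero => intro z; simp [ind]
    | succ n ih =>
      intro z
      rw [tsum_list_cons]
      by_cases hz : S z
      · simpa [firstHit_cons, firstHit_nil, hz, ind] using hS z hz
      · refine le_trans ?_ ((Finset.sum_le_sum fun a _ => ih (z ++ [a])).trans (hH z))
        simp only [firstHit_cons, hz, not_false_eq_true, true_and, List.length_cons,
          add_lt_add_iff_right, ind_false (fun h => hz ((firstHit_nil S z).1 (And.right h))),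
          zero_mul, zero_add, List.append_assoc, List.singleton_append, le_refl]
  unfold hitSum
  rw [ENNReal.tsum_eq_iSup_sum]
  refine iSup_le fun s => ?_
  refine le_trans ?_ (key (s.sup List.length + 1) z)
  refine le_trans (Finset.sum_le_sum fun w hw => ?_) (ENNReal.sum_le_tsum s)
  refine mul_le_mul_left (ind_mono fun h => ⟨?_, h⟩) _
  exact Nat.lt_succ_of_le (Finset.le_sup (f := List.length) hw)

/-- If every long enough prolongation of `z` lies in `S`, then `hitSum S φ z` dominates each
subadditive function that lies below `φ` on `S`. -/
theorem le_hitSum [Fintype X] {S : List X → Prop} {φ θ : List X → ℝ≥0∞} {P : List X → Prop}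
    (hP : ∀ z a, P z → P (z ++ [a])) (hS : ∀ z, P z → S z → θ z ≤ φ z) (t : ℕ)
    (ht : ∀ z, P z → t ≤ z.length → S z) (hθ : ∀ z, θ z ≤ ∑ a : X, θ (z ++ [a]))
    {z : List X} (hz : P z) : θ z ≤ hitSum S φ z := by
  obtain ⟨n, hn⟩ : ∃ n, t ≤ z.length + n := ⟨t, by omega⟩
  induction n generalizing z with
  | zero =>
    have hs := ht z hz hn
    rw [hitSum_of_mem φ hs]
    exact hS z hz hs
  | succ n ih =>
    by_cases hs : S z
    · rw [hitSum_of_mem φ hs]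
      exact hS z hz hs
    · rw [hitSum_of_notMem φ hs]
      refine (hθ z).trans (Finset.sum_le_sum fun a _ => ih (hP z a hz) ?_)
      simp
      omega

end Tree

/-- Kraft's inequality, for a prefix-free set of strings given as a predicate. -/
theorem tsum_prefixFree_le_one {D : List Bool → Prop}
    (hD : ∀ p q, D p → D q → p <+: q → p = q) :
    ∑' p : List Bool, ind (D p) * (2⁻¹ : ℝ≥0∞) ^ p.length ≤ 1 := by
  have h := hitSum_le (S := D) (φ := fun p => (2⁻¹ : ℝ≥0∞) ^ p.length)
    (H := fun p => (2⁻¹ : ℝ≥0∞) ^ p.length) (fun _ _ => le_rfl) (fun z => by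
      simp only [List.length_append, List.length_singleton, Finset.sum_const, Finset.card_univ,
        Fintype.card_bool, pow_succ]
      rw [nsmul_eq_mul, mul_left_comm]
      norm_num [ENNReal.mul_inv_cancel]) []
  refine le_trans (ENNReal.tsum_le_tsum fun p => ?_) (h.trans (by simp))
  refine mul_le_mul_left (ind_mono fun hp => ?_) _
  refine ⟨hp, fun k hk hk' => ?_⟩
  have := hD _ _ hk' hp (List.take_prefix k p)
  have := congrArg List.length this
  simp at this
  omega

/-! ### Mixtures over programs that read their condition -/

section Bounded

variable {α : Type*} [Primcodable α]

theorem primrecPred_exists_lt {R : ℕ → α → Prop} (hR : PrimrecRel R) {n : α → ℕ}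
    (hn : Primrec n) : PrimrecPred fun a => ∃ i < n a, R i a :=
  (hR.exists_mem_list.comp (Primrec.list_range.comp hn) .id).of_eq (by simp)

theorem primrecPred_forall_lt {R : ℕ → α → Prop} (hR : PrimrecRel R) {n : α → ℕ}
    (hn : Primrec n) : PrimrecPred fun a => ∀ i < n a, R i a :=
  (hR.forall_mem_list.comp (Primrec.list_range.comp hn) .id).of_eq (by simp)

theorem primrec_two_pow : Primrec fun n : ℕ => 2 ^ n :=
  (Primrec₂.unpaired'.1 Nat.Primrec.pow).comp (.const 2) .id

theorem inv_two_pow_eq_frac (n : ℕ) : (2⁻¹ : ℝ≥0∞) ^ n = frac 1 (2 ^ n - 1) := by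
  have h : ((2 ^ n - 1 : ℕ) : ℝ≥0∞) + 1 = 2 ^ n := by
    exact_mod_cast Nat.sub_add_cancel (Nat.one_le_two_pow (n := n))
  rw [frac, h, ← ENNReal.inv_pow]
  simp

theorem LSC.inv_two_pow {n : α → ℕ} (hn : Primrec n) : LSC fun a => (2⁻¹ : ℝ≥0∞) ^ n a :=
  (LSC.frac (.const 1) (Primrec.pred.comp (primrec_two_pow.comp hn))).of_eq fun a =>
    (inv_two_pow_eq_frac (n a)).symm

theorem LSC.levelSum {X : Type*} [Primcodable X] {f : α → List X → ℝ≥0∞}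
    (hf : LSC fun a : α × List X => f a.1 a.2) {n : α → ℕ} (hn : Primrec n) :
    LSC fun a => levelSum (n a) (f a) := by
  refine LSC.tsum (f := fun a w => AIT.ind (w.length = n a) * f a w) ?_
  exact (LSC.ind (rePred_of_primrecPred
    (Primrec.eq.comp (Primrec.list_length.comp .snd) (hn.comp .fst)))).mul hf

theorem LSC.hitSum {X : Type*} [Primcodable X] {S : α → List X → Prop}
    (hS : PrimrecPred fun a : α × List X => S a.1 a.2) {φ : α → List X → ℝ≥0∞}
    (hφ : LSC fun a : α × List X => φ a.1 a.2) :
    LSC fun a : α × List X => hitSum (S a.1) (φ a.1) a.2 := by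
  refine LSC.tsum (f := fun (a : α × List X) w =>
    AIT.ind (FirstHit (S a.1) a.2 w) * φ a.1 (a.2 ++ w)) ?_
  have hcat : Primrec fun q : (α × List X) × List X => (q.1.1, q.1.2 ++ q.2) :=
    Primrec.pair (Primrec.fst.comp .fst) (Primrec.list_append.comp (Primrec.snd.comp .fst) .snd)
  refine LSC.mul (LSC.ind (rePred_of_primrecPred (PrimrecPred.and (hS.comp hcat) ?_))) (hφ.comp hcat)
  refine primrecPred_forall_lt (R := fun k (q : (α × List X) × List X) =>
    ¬ S q.1.1 (q.1.2 ++ q.2.take k)) (PrimrecPred.not ?_) (Primrec.list_length.comp .snd)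
  have hk : Primrec fun c : ℕ × ((α × List X) × List X) =>
      (c.2.1.1, c.2.1.2 ++ c.2.2.take c.1) :=
    Primrec.pair (Primrec.fst.comp (Primrec.fst.comp .snd))
      (Primrec.list_append.comp (Primrec.snd.comp (Primrec.fst.comp .snd))
        (Primrec.list_take.comp .fst (Primrec.snd.comp .snd)))
  exact hS.comp hk

end Bounded

/-- A system of tests. A tape `p` and a string `x` assign at most one label `l`, consistently
under prolongation of both; a label comes with a weight function `ψ l` on strings and with an
enumerable test `A l` that guarantees `ψ l ≤ M` at the strings that pass it. -/
structure TestSystem (X L : Type*) [Fintype X] [Primcodable X] [Primcodable L] where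
  E : List Bool → List X → L → Prop
  A : L → List X → Prop
  ψ : L → List X → ℝ≥0∞
  M : List X → ℝ≥0∞
  re_E : REPred fun t : List Bool × List X × L => E t.1 t.2.1 t.2.2
  functional : ∀ p x l l', E p x l → E p x l' → l = l'
  prolong : ∀ p p' x x' l, E p x l → p <+: p' → x <+: x' → E p' x' l
  re_A : REPred fun t : L × List X => A t.1 t.2
  lsc_ψ : LSC fun t : L × List X => ψ t.1 t.2
  ψ_superadditive : ∀ l x, ∑ a : X, ψ l (x ++ [a]) ≤ ψ l x
  semimeasure_M : IsSemimeasure M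
  ψ_le : ∀ l x, A l x → ψ l x ≤ M x

namespace TestSystem

variable {X L : Type*} [Fintype X] [Primcodable X] [Primcodable L] (D : TestSystem X L)

/-- On the tape `p`, the string `z` has a prefix that has received the label `l` and passed its
test. -/
def Labelled (p : List Bool) (z : List X) (l : L) : Prop :=
  ∃ k, D.E p (z.take k) l ∧ D.A l (z.take k)

variable {D}

theorem Labelled.unique {p : List Bool} {z : List X} {l l' : L} (h : D.Labelled p z l)
    (h' : D.Labelled p z l') : l = l' := by
  obtain ⟨k, h1, -⟩ := h
  obtain ⟨k', h2, -⟩ := h'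
  exact D.functional p z l l'
    (D.prolong _ _ _ _ _ h1 (List.prefix_refl p) (List.take_prefix k z))
    (D.prolong _ _ _ _ _ h2 (List.prefix_refl p) (List.take_prefix k' z))

theorem Labelled.mono {p p' : List Bool} {z z' : List X} {l : L} (h : D.Labelled p z l)
    (hp : p <+: p') (hz : z <+: z') : D.Labelled p' z' l := by
  obtain ⟨k, h1, h2⟩ := h
  obtain ⟨w, rfl⟩ := hz
  have ht : (z ++ w).take (min k z.length) = z.take k := by
    rw [List.take_append_of_le_length (min_le_right _ _), ← List.take_eq_take_min]
  exact ⟨min k z.length, by rw [ht]; exact D.prolong _ _ _ _ _ h1 hp (List.prefix_refl _),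
    by rwa [ht]⟩

variable (D)

/-- The weight of `z` for the label that it carries on the tape `p`. -/
noncomputable def weight (p : List Bool) (z : List X) : ℝ≥0∞ :=
  ∑' l, ind (D.Labelled p z l) * D.ψ l z

variable {D}

theorem weight_eq {p : List Bool} {z : List X} {l : L} (h : D.Labelled p z l) :
    D.weight p z = D.ψ l z := by
  unfold weight
  rw [tsum_eq_single l]
  · simp [ind_true h]
  · intro l' hl'
    rw [ind_false fun h' => hl' (h'.unique h), zero_mul]

theorem weight_mono {p p' : List Bool} (hp : p <+: p') (z : List X) :
    D.weight p z ≤ D.weight p' z :=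
  ENNReal.tsum_le_tsum fun _ => mul_le_mul_left (ind_mono fun h => h.mono hp (List.prefix_refl z)) _

variable (D)

open Classical in
/-- The weight of labelled strings, and `M` elsewhere. -/
noncomputable def majorant (p : List Bool) (z : List X) : ℝ≥0∞ :=
  if ∃ l, D.Labelled p z l then D.weight p z else D.M z

variable {D}

theorem majorant_eq {p : List Bool} {z : List X} {l : L} (h : D.Labelled p z l) :
    D.majorant p z = D.ψ l z := by
  unfold majorant
  rw [if_pos ⟨l, h⟩, weight_eq h]

/-- A string without a label gets one from `z` to `z ++ [a]` only if `z ++ [a]` itself has passed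
the test, where the weight is at most `M`; from then on the label, hence the weight function, stays
the same. -/
theorem majorant_superadditive (p : List Bool) (z : List X) :
    ∑ a : X, D.majorant p (z ++ [a]) ≤ D.majorant p z := by
  by_cases h : ∃ l, D.Labelled p z l
  · obtain ⟨l, hl⟩ := h
    rw [majorant_eq hl]
    refine le_trans (Finset.sum_le_sum fun a _ => le_of_eq ?_) (D.ψ_superadditive l z)
    exact majorant_eq (hl.mono (List.prefix_refl p) (List.prefix_append z [a]))
  · have hz : D.majorant p z = D.M z := if_neg h
    rw [hz]
    refine le_trans (Finset.sum_le_sum fun a _ => ?_) (D.semimeasure_M.2 z)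
    by_cases h' : ∃ l, D.Labelled p (z ++ [a]) l
    · obtain ⟨l, hl⟩ := h'
      rw [majorant_eq hl]
      -- `z` carries no label, so the string that passed the test is `z ++ [a]` itself.
      obtain ⟨k, h1, h2⟩ := hl
      by_cases hk : k ≤ z.length
      · rw [List.take_append_of_le_length hk] at h1 h2
        exact absurd ⟨l, k, h1, h2⟩ h
      · rw [List.take_of_length_le (by simp; omega)] at h2
        exact D.ψ_le l _ h2
    · exact le_of_eq (if_neg h')

theorem majorant_nil_le_one (p : List Bool) : D.majorant p [] ≤ 1 := by
  refine le_trans ?_ D.semimeasure_M.1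
  by_cases h : ∃ l, D.Labelled p [] l
  · obtain ⟨l, hl⟩ := h
    rw [majorant_eq hl]
    obtain ⟨k, -, h2⟩ := hl
    rw [List.take_nil] at h2
    exact D.ψ_le l _ h2
  · exact le_of_eq (if_neg h)

variable (D)

theorem exists_stage : ∃ f : List Bool × List X → ℕ → Prop, PrimrecRel f ∧
    (∀ a m n, m ≤ n → f a m → f a n) ∧
    ∀ a, (∃ l, D.E a.1 a.2 l ∧ D.A l a.2) ↔ ∃ n, f a n := by
  refine exists_primrec_stage (rePred_exists
    (p := fun (a : List Bool × List X) l => D.E a.1 a.2 l ∧ D.A l a.2) (rePred_and ?_ ?_))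
  · exact rePred_comp D.re_E (f := fun t : (List Bool × List X) × L => (t.1.1, t.1.2, t.2))
      (.pair (Computable.fst.comp .fst) (.pair (Computable.snd.comp .fst) .snd))
  · exact rePred_comp D.re_A (f := fun t : (List Bool × List X) × L => (t.2, t.1.2))
      (.pair .snd (Computable.snd.comp .fst))

/-- A decidable approximation of test passing: `stage a n` says that within `n` steps the pair
`a` of tape and string is seen to receive a label and to pass its test. -/
noncomputable def stage : List Bool × List X → ℕ → Prop := D.exists_stage.choose

theorem primrec_stage : PrimrecRel D.stage := D.exists_stage.choose_spec.1

variable {D}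

theorem stage_mono {a : List Bool × List X} {m n : ℕ} (h : m ≤ n) (ha : D.stage a m) :
    D.stage a n :=
  D.exists_stage.choose_spec.2.1 a m n h ha

theorem exists_stage_iff {p : List Bool} {x : List X} :
    (∃ n, D.stage (p, x) n) ↔ ∃ l, D.E p x l ∧ D.A l x :=
  (D.exists_stage.choose_spec.2.2 (p, x)).symm

variable (D)

/-- The string `z` is stopped on the tape `p` if within `z.length` steps some prefix of `z` is seen
to pass its test for some prefix of `p`. This is decidable, and for fixed `p` every long enough
string with a prefix that passes its test is stopped. -/
def Stopped (p : List Bool) (z : List X) : Prop :=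
  ∃ i < p.length + 1, ∃ k < z.length + 1, D.stage (p.take i, z.take k) z.length

theorem primrecPred_stopped : PrimrecPred fun a : List Bool × List X => D.Stopped a.1 a.2 := by
  refine primrecPred_exists_lt (R := fun i (a : List Bool × List X) =>
    ∃ k < a.2.length + 1, D.stage (a.1.take i, a.2.take k) a.2.length) ?_
    (Primrec.succ.comp (Primrec.list_length.comp .fst))
  refine primrecPred_exists_lt (R := fun k (c : ℕ × List Bool × List X) =>
    D.stage (c.2.1.take c.1, c.2.2.take k) c.2.2.length) ?_
    (Primrec.succ.comp (Primrec.list_length.comp (Primrec.snd.comp .snd)))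
  have h1 : Primrec fun e : ℕ × ℕ × List Bool × List X => e.2.2.2 :=
    Primrec.snd.comp (Primrec.snd.comp .snd)
  have h2 : Primrec fun e : ℕ × ℕ × List Bool × List X => e.2.2.1.take e.2.1 :=
    Primrec.list_take.comp (Primrec.fst.comp .snd) (Primrec.fst.comp (Primrec.snd.comp .snd))
  exact PrimrecRel.comp D.primrec_stage
    (Primrec.pair h2 (Primrec.list_take.comp .fst h1)) (Primrec.list_length.comp h1)

variable {D}

theorem Stopped.labelled {p : List Bool} {z : List X} (h : D.Stopped p z) :
    ∃ l, D.Labelled p z l := by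
  obtain ⟨i, -, k, -, h⟩ := h
  obtain ⟨l, h1, h2⟩ := exists_stage_iff.1 ⟨_, h⟩
  exact ⟨l, k, D.prolong _ _ _ _ _ h1 (List.take_prefix i p) (List.prefix_refl _), h2⟩

theorem Stopped.mono {p p' : List Bool} {z : List X} (h : D.Stopped p z) (hp : p <+: p') :
    D.Stopped p' z := by
  obtain ⟨i, hi, h⟩ := h
  obtain ⟨w, rfl⟩ := hp
  refine ⟨i, by rw [List.length_append]; omega, ?_⟩
  rwa [List.take_append_of_le_length (by omega)]

variable (D)

/-- The superadditive function generated by the weights on the tape `p`. -/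
noncomputable def tapeSum (p : List Bool) (z : List X) : ℝ≥0∞ :=
  hitSum (D.Stopped p) (D.weight p) z

theorem re_labelled :
    REPred fun t : (List Bool × List X) × L => D.Labelled t.1.1 t.1.2 t.2 := by
  have h1 : Primrec fun t : ((List Bool × List X) × L) × ℕ => t.1.1.2.take t.2 :=
    Primrec.list_take.comp .snd (Primrec.snd.comp (Primrec.fst.comp .fst))
  have h2 : Primrec fun t : ((List Bool × List X) × L) × ℕ =>
      (t.1.1.1, t.1.1.2.take t.2, t.1.2) :=
    Primrec.pair (Primrec.fst.comp (Primrec.fst.comp .fst))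
      (Primrec.pair h1 (Primrec.snd.comp .fst))
  have h3 : Primrec fun t : ((List Bool × List X) × L) × ℕ => (t.1.2, t.1.1.2.take t.2) :=
    Primrec.pair (Primrec.snd.comp .fst) h1
  have h4 : REPred fun t : ((List Bool × List X) × L) × ℕ =>
      D.E t.1.1.1 (t.1.1.2.take t.2) t.1.2 := rePred_comp (β := List Bool × List X × L)
    (p := fun t => D.E t.1 t.2.1 t.2.2) D.re_E
    (f := fun t : ((List Bool × List X) × L) × ℕ => (t.1.1.1, t.1.1.2.take t.2, t.1.2)) h2.to_comp
  have h5 : REPred fun t : ((List Bool × List X) × L) × ℕ =>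
      D.A t.1.2 (t.1.1.2.take t.2) := rePred_comp (β := L × List X) (p := fun t => D.A t.1 t.2)
    D.re_A (f := fun t : ((List Bool × List X) × L) × ℕ => (t.1.2, t.1.1.2.take t.2)) h3.to_comp
  exact rePred_exists (p := fun (t : (List Bool × List X) × L) k =>
    D.E t.1.1 (t.1.2.take k) t.2 ∧ D.A t.2 (t.1.2.take k)) (rePred_and h4 h5)

theorem lsc_weight : LSC fun a : List Bool × List X => D.weight a.1 a.2 := by
  have h1 : LSC fun t : (List Bool × List X) × L => D.ψ t.2 t.1.2 :=
    D.lsc_ψ.comp (k := fun t : (List Bool × List X) × L => (t.2, t.1.2))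
      (Primrec.pair .snd (Primrec.snd.comp .fst))
  exact LSC.tsum (f := fun (a : List Bool × List X) l =>
    ind (D.Labelled a.1 a.2 l) * D.ψ l a.2) ((LSC.ind D.re_labelled).mul h1)

theorem lsc_tapeSum : LSC fun a : List Bool × List X => D.tapeSum a.1 a.2 :=
  LSC.hitSum D.primrecPred_stopped D.lsc_weight

variable {D}

theorem tapeSum_le_majorant (p : List Bool) (z : List X) : D.tapeSum p z ≤ D.majorant p z := by
  refine hitSum_le (fun z hz => ?_) (majorant_superadditive p) z
  obtain ⟨l, hl⟩ := hz.labelled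
  rw [weight_eq hl, majorant_eq hl]

theorem tapeSum_superadditive (p : List Bool) (z : List X) :
    ∑ a : X, D.tapeSum p (z ++ [a]) ≤ D.tapeSum p z := by
  by_cases hz : D.Stopped p z
  · have h : D.tapeSum p z = D.majorant p z := by
      obtain ⟨l, hl⟩ := hz.labelled
      rw [tapeSum, hitSum_of_mem _ hz, weight_eq hl, majorant_eq hl]
    rw [h]
    exact (Finset.sum_le_sum fun a _ => tapeSum_le_majorant p _).trans (majorant_superadditive p z)
  · exact (hitSum_of_notMem _ hz).ge

theorem tapeSum_mono {p p' : List Bool} (hp : p <+: p') (z : List X) :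
    D.tapeSum p z ≤ D.tapeSum p' z := by
  refine hitSum_le (fun z hz => ?_) (tapeSum_superadditive p') z
  rw [tapeSum, hitSum_of_mem _ (hz.mono hp)]
  exact weight_mono hp z

/-- The tape sum of `r` dominates the weight function of a label that `r` assigns at `x`, above
`x`. Additivity is needed since a string may be stopped only long after the test has been passed. -/
theorem le_tapeSum {r : List Bool} {x : List X} {l : L} (hE : D.E r x l) (hA : D.A l x)
    (hl : ∀ z, ∑ a : X, D.ψ l (z ++ [a]) = D.ψ l z) {z : List X} (hz : x <+: z) :
    D.ψ l z ≤ D.tapeSum r z := by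
  obtain ⟨t, ht⟩ := exists_stage_iff.2 ⟨l, hE, hA⟩
  have hlab : ∀ z, x <+: z → D.Labelled r z l := fun z hz =>
    Labelled.mono ⟨x.length, by rwa [List.take_length], by rwa [List.take_length]⟩
      (List.prefix_refl r) hz
  refine le_hitSum (P := fun z => x <+: z) (fun z a h => h.trans (List.prefix_append z [a]))
    (fun z hz _ => (weight_eq (hlab z hz)).ge) t (fun z hz hlen => ?_) (fun z => (hl z).ge) hz
  refine ⟨r.length, Nat.lt_succ_self _, x.length, Nat.lt_succ_of_le hz.length_le, ?_⟩
  rw [List.take_length, ← List.prefix_iff_eq_take.1 hz]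
  exact stage_mono hlen ht

variable (D)

/-- The average of the tape sums over all tapes of length `N`. -/
noncomputable def average (N : ℕ) (z : List X) : ℝ≥0∞ :=
  (2⁻¹ : ℝ≥0∞) ^ N * levelSum N fun p => D.tapeSum p z

variable {D}

/-- The average grows with the length of the tapes because a tape sum grows when its tape is
prolonged. -/
theorem average_mono (z : List X) : Monotone fun N => D.average N z := by
  refine monotone_nat_of_le_succ fun N => ?_
  unfold average
  rw [levelSum_succ, pow_succ, mul_assoc]
  refine mul_le_mul_right ?_ _
  have h : levelSum N (fun p => 2 * D.tapeSum p z) ≤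
      levelSum N fun p => ∑ b : Bool, D.tapeSum (p ++ [b]) z := by
    refine levelSum_mono fun p _ => ?_
    rw [two_mul, Fintype.sum_bool]
    exact add_le_add (tapeSum_mono (List.prefix_append _ _) z)
      (tapeSum_mono (List.prefix_append _ _) z)
  refine le_trans (le_of_eq ?_) (mul_le_mul_right h _)
  unfold levelSum
  rw [← ENNReal.tsum_mul_left]
  refine tsum_congr fun p => ?_
  rw [mul_left_comm, ← mul_assoc (2⁻¹ : ℝ≥0∞), ENNReal.inv_mul_cancel (by simp) (by simp), one_mul]

theorem average_superadditive (N : ℕ) (z : List X) :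
    ∑ a : X, D.average N (z ++ [a]) ≤ D.average N z := by
  unfold average
  rw [← Finset.mul_sum]
  refine mul_le_mul_right ?_ _
  unfold levelSum
  rw [← Summable.tsum_finsetSum fun _ _ => ENNReal.summable]
  refine ENNReal.tsum_le_tsum fun p => ?_
  rw [← Finset.mul_sum]
  exact mul_le_mul_right (tapeSum_superadditive p z) _

theorem average_nil_le_one (N : ℕ) : D.average N [] ≤ 1 := by
  unfold average
  refine (mul_le_mul_right (levelSum_mono (g := fun _ => 1) fun p _ =>
    (tapeSum_le_majorant p []).trans (majorant_nil_le_one p)) _).trans ?_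
  rw [levelSum_const, mul_one, Fintype.card_bool, ← ENNReal.inv_pow]
  exact_mod_cast ENNReal.inv_mul_le_one _

variable (D)

/-- An enumerable semimeasure that dominates, up to the weight of the program, the weight function
of every label that some program assigns. -/
theorem exists_semimeasure : ∃ ρ : List X → ℝ≥0∞, IsSemimeasure ρ ∧ LSC ρ ∧
    ∀ r x l, D.E r x l → D.A l x → (∀ z, ∑ a : X, D.ψ l (z ++ [a]) = D.ψ l z) →
      ∀ z, x <+: z → (2⁻¹ : ℝ≥0∞) ^ r.length * D.ψ l z ≤ ρ z := by
  refine ⟨fun z => ⨆ N, D.average N z, ⟨iSup_le average_nil_le_one, fun z => ?_⟩, ?_, ?_⟩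
  · rw [ENNReal.finsetSum_iSup_of_monotone fun a => average_mono (z ++ [a])]
    exact iSup_mono fun N => average_superadditive N z
  · refine LSC.iSup (f := fun z N => D.average N z) (LSC.mul (LSC.inv_two_pow .snd) ?_)
    refine LSC.levelSum (f := fun (a : List X × ℕ) p => D.tapeSum p a.1) ?_ .snd
    exact D.lsc_tapeSum.comp (Primrec.pair .snd (Primrec.fst.comp .fst))
  · intro r x l hE hA hl z hz
    refine le_trans ?_ (le_iSup (fun N => D.average N z) r.length)
    exact mul_le_mul_right ((le_tapeSum hE hA hl hz).trans
      (le_levelSum (fun p => D.tapeSum p z) r)) _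

end TestSystem

/-! ### Complexities and Solomonoff's prior -/

theorem iInf_length_eq_top_or_attained (P : List Bool → Prop) :
    (⨅ (p : List Bool) (_ : P p), (p.length : ℕ∞)) = ⊤ ∨
      ∃ p, P p ∧ (⨅ (p : List Bool) (_ : P p), (p.length : ℕ∞)) = p.length := by
  by_cases h : ∃ p, P p
  · obtain ⟨p, hp, hmin⟩ := (measure List.length).wf.has_min {p | P p} h
    refine Or.inr ⟨p, hp, le_antisymm (iInf₂_le p hp) (le_iInf₂ fun q hq => ?_)⟩
    exact_mod_cast not_lt.1 (hmin q hq)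
  · push Not at h
    left
    simp [h]

theorem twoPowNeg_coe (n : ℕ) : twoPowNeg (n : ℕ∞) = (2⁻¹ : ℝ≥0∞) ^ n := rfl

theorem twoPowNeg_top : twoPowNeg ⊤ = 0 := rfl

theorem inv_two_pow_le {m n : ℕ} (h : m ≤ n) : (2⁻¹ : ℝ≥0∞) ^ n ≤ (2⁻¹ : ℝ≥0∞) ^ m :=
  pow_le_pow_right_of_le_one' (by simp) h

namespace PrefixMachine

theorem K_eq_top_or_attained (U : PrefixMachine) (n : ℕ) :
    U.K n = ⊤ ∨ ∃ p, n ∈ U.run p ∧ U.K n = p.length :=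
  iInf_length_eq_top_or_attained fun p => n ∈ U.run p

/-- The weight `2 ^ (-K(n))` is approximated from below by the programs found for `n`. -/
theorem twoPowNeg_K_eq_iSup (U : PrefixMachine) (n : ℕ) :
    twoPowNeg (U.K n) = ⨆ p, ind (n ∈ U.run p) * (2⁻¹ : ℝ≥0∞) ^ p.length := by
  apply le_antisymm
  · rcases U.K_eq_top_or_attained n with h | ⟨p, hp, h⟩
    · simp [h, twoPowNeg_top]
    · refine le_iSup_of_le p ?_
      rw [h, twoPowNeg_coe, ind_true hp, one_mul]
  · refine iSup_le fun p => ?_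
    by_cases hp : n ∈ U.run p
    · have hle : U.K n ≤ p.length := iInf₂_le p hp
      rcases U.K_eq_top_or_attained n with h | ⟨q, -, h⟩
      · simp [h] at hle
      · rw [h] at hle ⊢
        rw [ind_true hp, one_mul, twoPowNeg_coe]
        exact inv_two_pow_le (by exact_mod_cast hle)
    · simp [ind_false hp]

theorem lsc_twoPowNeg_K (U : PrefixMachine) : LSC fun n => twoPowNeg (U.K n) := by
  have h : LSC fun a : ℕ × List Bool => ind (a.1 ∈ U.run a.2) * (2⁻¹ : ℝ≥0∞) ^ a.2.length :=
    (LSC.ind (rePred_comp (rePred_mem_of_partrec U.partrec)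
      (f := fun a : ℕ × List Bool => (a.2, a.1)) (.pair .snd .fst))).mul
      (LSC.inv_two_pow (Primrec.list_length.comp .snd))
  exact (LSC.iSup (f := fun n p => ind (n ∈ U.run p) * (2⁻¹ : ℝ≥0∞) ^ p.length) h).of_eq
    fun n => (U.twoPowNeg_K_eq_iSup n).symm

theorem tsum_twoPowNeg_K_le_one (U : PrefixMachine) : ∑' n, twoPowNeg (U.K n) ≤ 1 := by
  calc ∑' n, twoPowNeg (U.K n)
      ≤ ∑' n, ∑' p, ind (n ∈ U.run p) * (2⁻¹ : ℝ≥0∞) ^ p.length := by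
        refine ENNReal.tsum_le_tsum fun n => ?_
        rw [twoPowNeg_K_eq_iSup]
        exact iSup_le fun p => ENNReal.le_tsum p
    _ = ∑' p, ∑' n, ind (n ∈ U.run p) * (2⁻¹ : ℝ≥0∞) ^ p.length := ENNReal.tsum_comm
    _ = ∑' p, ind (U.run p).Dom * (2⁻¹ : ℝ≥0∞) ^ p.length := by
        refine tsum_congr fun p => ?_
        rw [ENNReal.tsum_mul_right]
        congr 1
        by_cases hp : (U.run p).Dom
        · rw [ind_true hp, tsum_eq_single ((U.run p).get hp), ind_true (Part.get_mem hp)]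
          intro n hn
          exact ind_false fun h => hn (Part.get_eq_of_mem h hp).symm
        · rw [ind_false hp, ENNReal.tsum_eq_zero]
          intro n
          exact ind_false fun h => hp (Part.dom_iff_mem.2 ⟨n, h⟩)
    _ ≤ 1 := tsum_prefixFree_le_one U.prefixFree

/-- The machine whose only program is the empty one, with output `n`. -/
def constant (n : ℕ) : PrefixMachine where
  run p := cond (decide (p = [])) (Part.some n) Part.none
  partrec := Partrec.cond (Primrec.to_comp (PrimrecPred.decide
    (Primrec.eq.comp .id (.const [])))) (Computable.const n).partrec .none
  prefixFree p q hp hq _ := by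
    have h : ∀ r : List Bool, (cond (decide (r = [])) (Part.some n) Part.none).Dom → r = [] := by
      intro r hr
      by_contra hne
      simp [hne] at hr
    rw [h p hp, h q hq]

theorem IsOptimal.K_ne_top {U : PrefixMachine} (hU : U.IsOptimal) (n : ℕ) : U.K n ≠ ⊤ := by
  obtain ⟨c, hc⟩ := hU (constant n)
  have h : (constant n).K n ≤ (([] : List Bool).length : ℕ∞) :=
    iInf₂_le (f := fun p (_ : n ∈ (constant n).run p) => (p.length : ℕ∞)) [] (by simp [constant])
  refine ne_top_of_le_ne_top ?_ ((hc n).trans (add_le_add_left h c))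
  simp

end PrefixMachine

section Solomonoff

variable {X : Type*}

theorem IsSemimeasure.le_one [Fintype X] {ρ : List X → ℝ≥0∞} (h : IsSemimeasure ρ) (x : List X) : ρ x ≤ 1 :=
  ((le_levelSum ρ x).trans (levelSum_le_of_superadditive h.2 _)).trans h.1

theorem isSemimeasure_solomonoff [Fintype X] (U : PrefixMachine) {ν : ℕ → List X → ℝ≥0∞}
    (hν : ∀ T, IsSemimeasure (ν T)) : IsSemimeasure (solomonoff U ν) := by
  constructor
  · refine le_trans (ENNReal.tsum_le_tsum fun T => ?_) U.tsum_twoPowNeg_K_le_one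
    exact mul_le_of_le_one_right zero_le (hν T).1
  · intro x
    unfold solomonoff
    rw [← Summable.tsum_finsetSum fun _ _ => ENNReal.summable]
    refine ENNReal.tsum_le_tsum fun T => ?_
    rw [← Finset.mul_sum]
    exact mul_le_mul_right ((hν T).2 x) _

theorem le_solomonoff (U : PrefixMachine) (ν : ℕ → List X → ℝ≥0∞) (T : ℕ) (x : List X) :
    twoPowNeg (U.K T) * ν T x ≤ solomonoff U ν x :=
  ENNReal.le_tsum (f := fun T => twoPowNeg (U.K T) * ν T x) T

variable [Primcodable X]

theorem IsEffectiveEnumeration.lsc [Fintype X] {ν : ℕ → List X → ℝ≥0∞} (hν : IsEffectiveEnumeration ν) :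
    LSC fun a : ℕ × List X => ν a.1 a.2 := by
  refine LSC.of_rePred_frac_lt ?_
  exact rePred_comp hν.2.1 (f := fun a : (ℕ × List X) × ℕ × ℕ => (a.1.1, a.1.2, a.2))
    (.pair (Computable.fst.comp .fst) (.pair (Computable.snd.comp .fst) .snd))

theorem lsc_solomonoff (U : PrefixMachine) {ν : ℕ → List X → ℝ≥0∞}
    (hν : LSC fun a : ℕ × List X => ν a.1 a.2) : LSC (solomonoff U ν) := by
  have h1 : LSC fun a : List X × ℕ => twoPowNeg (U.K a.2) := U.lsc_twoPowNeg_K.comp .snd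
  have h2 : LSC fun a : List X × ℕ => ν a.2 a.1 :=
    hν.comp (k := fun a : List X × ℕ => (a.2, a.1)) (Primrec.pair .snd .fst)
  exact LSC.tsum (f := fun x T => twoPowNeg (U.K T) * ν T x) (h1.mul h2)

end Solomonoff

/-! ### From twice prefix machines to enumerable sets -/

namespace TwicePrefixMachine

variable {X : Type*} [Primcodable X] (V : TwicePrefixMachine X)

/-- The head positions on the two tapes after an action. -/
def advance (c : ℕ × ℕ) : TapeAction → ℕ × ℕ
  | .inl false => (c.1 + 1, c.2)
  | .inl true => (c.1, c.2 + 1)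
  | .inr _ => c

/-- The head positions after `j` actions on the tapes `p` and `x`; a machine that has halted
stays where it is. A head beyond the end of its tape has read `p` or `x` only, so that its later
positions are meaningless. -/
def simulate (p : List Bool) (x : List X) (j : ℕ) : Part (ℕ × ℕ) :=
  Nat.rec (Part.some (0, 0)) (fun _ s => s.bind fun c =>
    (V.next (p.take c.1, x.take c.2)).map (advance c)) j

theorem partrec_simulate :
    Partrec fun a : (List Bool × List X) × ℕ => V.simulate a.1.1 a.1.2 a.2 := by
  refine Partrec.nat_rec (f := fun a : (List Bool × List X) × ℕ => a.2)
    (g := fun _ => Part.some (0, 0))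
    (h := fun a s => (V.next (a.1.1.take s.2.1, a.1.2.take s.2.2)).map (advance s.2))
    .snd (Computable.const (0, 0)).partrec ?_
  refine Partrec.map (g := fun (b : ((List Bool × List X) × ℕ) × ℕ × ℕ × ℕ) t =>
    advance b.2.2 t) (V.partrec.comp ?_) ?_
  · have h2 : Primrec fun b : ((List Bool × List X) × ℕ) × ℕ × ℕ × ℕ => b.2.2 :=
      Primrec.snd.comp .snd
    have h1 : Primrec fun b : ((List Bool × List X) × ℕ) × ℕ × ℕ × ℕ => b.1.1 :=
      Primrec.fst.comp .fst
    exact (Primrec.pair (Primrec.list_take.comp (Primrec.fst.comp h2) (Primrec.fst.comp h1))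
      (Primrec.list_take.comp (Primrec.snd.comp h2) (Primrec.snd.comp h1))).to_comp
  · have h : Primrec₂ fun (c : ℕ × ℕ) (t : TapeAction) => advance c t := by
      refine (Primrec.sumCasesOn (f := fun a : (ℕ × ℕ) × TapeAction => a.2)
        (g := fun a b => cond b (a.1.1, a.1.2 + 1) (a.1.1 + 1, a.1.2)) (h := fun a _ => a.1)
        .snd ?_ (Primrec.fst.comp .fst)).of_eq ?_
      · have h1 : Primrec fun b : ((ℕ × ℕ) × TapeAction) × Bool => b.1.1.1 :=
          Primrec.fst.comp (Primrec.fst.comp .fst)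
        have h2 : Primrec fun b : ((ℕ × ℕ) × TapeAction) × Bool => b.1.1.2 :=
          Primrec.snd.comp (Primrec.fst.comp .fst)
        exact Primrec.cond .snd (Primrec.pair h1 (Primrec.succ.comp h2))
          (Primrec.pair (Primrec.succ.comp h1) h2)
      · rintro ⟨c, (_ | _) | n⟩ <;> rfl
    exact (h.comp (Primrec.snd.comp (Primrec.snd.comp .fst)) .snd).to_comp

variable {V}

theorem mem_simulate_succ {p : List Bool} {x : List X} {j : ℕ} {c : ℕ × ℕ} :
    c ∈ V.simulate p x (j + 1) ↔ ∃ b ∈ V.simulate p x j,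
      ∃ t ∈ V.next (p.take b.1, x.take b.2), advance b t = c := by
  simp [simulate]

theorem reads_of_simulate {p : List Bool} {x : List X} {j : ℕ} {c : ℕ × ℕ}
    (h : c ∈ V.simulate p x j) (h1 : c.1 ≤ p.length) (h2 : c.2 ≤ x.length) :
    V.Reads (p.take c.1) (x.take c.2) := by
  induction j generalizing c with
  | zero =>
    have : c = (0, 0) := by simpa [simulate] using h
    subst this
    simpa using Reads.start
  | succ j ih =>
    obtain ⟨⟨i, k⟩, hb, t, ht, rfl⟩ := mem_simulate_succ.1 h
    rcases t with (_ | _) | n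
    · simp only [advance] at h1 h2 ⊢
      rw [List.take_succ_eq_append_getElem h1]
      exact Reads.program _ _ _ (ih hb (by simp only; omega) h2) ht
    · simp only [advance] at h1 h2 ⊢
      rw [List.take_succ_eq_append_getElem h2]
      exact Reads.condition _ _ _ (ih hb h1 (by simp only; omega)) ht
    · exact ih hb h1 h2

theorem simulate_of_reads {p₀ p : List Bool} {x₀ x : List X} (h : V.Reads p₀ x₀)
    (hp : p₀ <+: p) (hx : x₀ <+: x) : ∃ j, (p₀.length, x₀.length) ∈ V.simulate p x j := by
  induction h with
  | start => exact ⟨0, by simp [simulate]⟩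
  | program p₀ x₀ b _ hn ih =>
    have hp' := (List.prefix_append p₀ [b]).trans hp
    obtain ⟨j, hj⟩ := ih hp' hx
    refine ⟨j + 1, mem_simulate_succ.2 ⟨_, hj, TapeAction.readProgram, ?_, by simp [advance]⟩⟩
    rwa [← List.prefix_iff_eq_take.1 hp', ← List.prefix_iff_eq_take.1 hx]
  | condition p₀ x₀ a _ hn ih =>
    have hx' := (List.prefix_append x₀ [a]).trans hx
    obtain ⟨j, hj⟩ := ih hp hx'
    refine ⟨j + 1, mem_simulate_succ.2 ⟨_, hj, TapeAction.readCondition, ?_, by simp [advance]⟩⟩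
    rwa [← List.prefix_iff_eq_take.1 hp, ← List.prefix_iff_eq_take.1 hx']

variable (V)

/-- On tapes beginning with `p` and `x`, the machine halts with output `n` without reading beyond
`p` and `x`. -/
def HaltsWithin (p : List Bool) (x : List X) (n : ℕ) : Prop :=
  ∃ p₀ x₀, p₀ <+: p ∧ x₀ <+: x ∧ V.Outputs p₀ x₀ n

variable {V}

theorem haltsWithin_iff {p : List Bool} {x : List X} {n : ℕ} :
    V.HaltsWithin p x n ↔ ∃ (j : ℕ) (c : ℕ × ℕ), c ∈ V.simulate p x j ∧
      (c.1 ≤ p.length ∧ c.2 ≤ x.length) ∧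
        TapeAction.halt n ∈ V.next (p.take c.1, x.take c.2) := by
  constructor
  · rintro ⟨p₀, x₀, hp, hx, hr, hh⟩
    obtain ⟨j, hj⟩ := simulate_of_reads hr hp hx
    refine ⟨j, _, hj, ⟨hp.length_le, hx.length_le⟩, ?_⟩
    rwa [← List.prefix_iff_eq_take.1 hp, ← List.prefix_iff_eq_take.1 hx]
  · rintro ⟨j, c, hc, ⟨h1, h2⟩, hh⟩
    exact ⟨_, _, List.take_prefix _ _, List.take_prefix _ _, reads_of_simulate hc h1 h2, hh⟩

theorem simulate_of_halt {p : List Bool} {x : List X} {n j : ℕ} {c : ℕ × ℕ}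
    (hc : c ∈ V.simulate p x j) (hh : TapeAction.halt n ∈ V.next (p.take c.1, x.take c.2)) (d : ℕ) :
    c ∈ V.simulate p x (j + d) := by
  induction d with
  | zero => exact hc
  | succ d ih => exact mem_simulate_succ.2 ⟨c, ih, _, hh, rfl⟩

/-- The machine is deterministic, and it stays where it has halted. -/
theorem HaltsWithin.unique {p : List Bool} {x : List X} {m n : ℕ} (hm : V.HaltsWithin p x m)
    (hn : V.HaltsWithin p x n) : m = n := by
  obtain ⟨j, c, hc, -, hm⟩ := haltsWithin_iff.1 hm
  obtain ⟨j', c', hc', -, hn⟩ := haltsWithin_iff.1 hn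
  have h := Part.mem_unique (simulate_of_halt hc hm j')
    (add_comm j' j ▸ simulate_of_halt hc' hn j)
  subst h
  exact Sum.inr_injective (Part.mem_unique hm hn)

variable (V)

theorem re_haltsWithin :
    REPred fun t : List Bool × List X × ℕ => V.HaltsWithin t.1 t.2.1 t.2.2 := by
  have h1 : REPred fun a : (List Bool × List X × ℕ) × ℕ × ℕ × ℕ =>
      a.2.2 ∈ V.simulate a.1.1 a.1.2.1 a.2.1 :=
    rePred_comp (rePred_mem_of_partrec V.partrec_simulate)
      (f := fun a : (List Bool × List X × ℕ) × ℕ × ℕ × ℕ =>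
        (((a.1.1, a.1.2.1), a.2.1), a.2.2))
      (.pair (.pair (.pair (Computable.fst.comp .fst) (Computable.fst.comp
        (Computable.snd.comp .fst))) (Computable.fst.comp .snd)) (Computable.snd.comp .snd))
  have hp : Primrec fun a : (List Bool × List X × ℕ) × ℕ × ℕ × ℕ => a.1.1 :=
    Primrec.fst.comp .fst
  have hx : Primrec fun a : (List Bool × List X × ℕ) × ℕ × ℕ × ℕ => a.1.2.1 :=
    Primrec.fst.comp (Primrec.snd.comp .fst)
  have hn : Primrec fun a : (List Bool × List X × ℕ) × ℕ × ℕ × ℕ => a.1.2.2 :=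
    Primrec.snd.comp (Primrec.snd.comp .fst)
  have hi : Primrec fun a : (List Bool × List X × ℕ) × ℕ × ℕ × ℕ => a.2.2.1 :=
    Primrec.fst.comp (Primrec.snd.comp .snd)
  have hk : Primrec fun a : (List Bool × List X × ℕ) × ℕ × ℕ × ℕ => a.2.2.2 :=
    Primrec.snd.comp (Primrec.snd.comp .snd)
  have h2 : REPred fun a : (List Bool × List X × ℕ) × ℕ × ℕ × ℕ =>
      a.2.2.1 ≤ a.1.1.length ∧ a.2.2.2 ≤ a.1.2.1.length :=
    rePred_of_primrecPred ((Primrec.nat_le.comp hi (Primrec.list_length.comp hp)).and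
      (Primrec.nat_le.comp hk (Primrec.list_length.comp hx)))
  have h3 : REPred fun a : (List Bool × List X × ℕ) × ℕ × ℕ × ℕ =>
      TapeAction.halt a.1.2.2 ∈ V.next (a.1.1.take a.2.2.1, a.1.2.1.take a.2.2.2) :=
    rePred_comp (rePred_mem_of_partrec V.partrec)
      (f := fun a : (List Bool × List X × ℕ) × ℕ × ℕ × ℕ =>
        ((a.1.1.take a.2.2.1, a.1.2.1.take a.2.2.2), TapeAction.halt a.1.2.2))
      (Primrec.pair (Primrec.pair (Primrec.list_take.comp hi hp) (Primrec.list_take.comp hk hx))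
        (Primrec.sumInr.comp hn)).to_comp
  refine (rePred_exists (p := fun (t : List Bool × List X × ℕ) (s : ℕ × ℕ × ℕ) =>
    s.2 ∈ V.simulate t.1 t.2.1 s.1 ∧ (s.2.1 ≤ t.1.length ∧ s.2.2 ≤ t.2.1.length) ∧
      TapeAction.halt t.2.2 ∈ V.next (t.1.take s.2.1, t.2.1.take s.2.2))
    (rePred_and h1 (rePred_and h2 h3))).of_eq fun t => ?_
  rw [haltsWithin_iff, Prod.exists]

end TwicePrefixMachine

/-- Either definition of `K_*(n|x*)` takes the minimum of `p.length` over a recursively enumerable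
set of triples `(p, x, n)` that is functional and closed under prolongation. -/
theorem IsKStar.exists_enumerable {X : Type*} [Primcodable X] {Kstar : ℕ → List X → ℕ∞}
    (h : IsKStar Kstar) : ∃ E : List Bool → List X → ℕ → Prop,
      (REPred fun t : List Bool × List X × ℕ => E t.1 t.2.1 t.2.2) ∧
      (∀ p x m n, E p x m → E p x n → m = n) ∧
      (∀ p p' x x' n, E p x n → p <+: p' → x <+: x' → E p' x' n) ∧
      ∀ n x, Kstar n x = ⊤ ∨ ∃ p, E p x n ∧ Kstar n x = p.length := by
  rcases h with ⟨V, -, rfl⟩ | ⟨E, ⟨hE, -⟩, rfl⟩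
  · refine ⟨V.HaltsWithin, V.re_haltsWithin, fun p x m n hm hn => hm.unique hn, ?_, fun n x => ?_⟩
    · rintro p p' x x' n ⟨p₀, x₀, hp, hx, ho⟩ hp' hx'
      exact ⟨p₀, x₀, hp.trans hp', hx.trans hx', ho⟩
    · refine (iInf_length_eq_top_or_attained fun p =>
        ∃ k ≤ x.length, V.Outputs p (x.take k) n).imp_right ?_
      rintro ⟨p, ⟨k, -, ho⟩, hp⟩
      exact ⟨p, ⟨p, x.take k, List.prefix_refl p, List.take_prefix k x, ho⟩, hp⟩
  · exact ⟨fun p x n => (p, x, n) ∈ E, hE.enumerable, hE.functional, hE.prolong, fun n x =>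
      iInf_length_eq_top_or_attained fun p => (p, x, n) ∈ E⟩

/-! ### Logarithms and weights of integer codes -/

theorem log2_ofReal {t : ℝ} (ht : 0 < t) :
    log2 (ENNReal.ofReal t) = ((Real.logb 2 t : ℝ) : EReal) := by
  rw [log2, ENNReal.log_ofReal_of_pos ht, ← EReal.coe_div]
  rfl

theorem log2_zero : log2 0 = ⊥ := by
  rw [log2, ENNReal.log_zero]
  exact EReal.bot_div_of_pos_ne_top (by exact_mod_cast Real.log_pos one_lt_two) (by simp)

theorem log2_top : log2 ⊤ = ⊤ := by
  rw [log2, ENNReal.log_top]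
  exact EReal.top_div_of_pos_ne_top (by exact_mod_cast Real.log_pos one_lt_two) (by simp)

theorem log2_le_natCast {a : ℝ≥0∞} {n : ℕ} (h : a ≤ 2 ^ n) : log2 a ≤ (n : EReal) := by
  have h1 : log2 a ≤ log2 (2 ^ n) := by
    refine EReal.div_le_div_right_of_nonneg ?_ (ENNReal.log_monotone h)
    exact_mod_cast (Real.log_pos one_lt_two).le
  have h2 : (2 : ℝ≥0∞) ^ n = ENNReal.ofReal (2 ^ n) := by
    rw [ENNReal.ofReal_pow (by norm_num)]
    norm_num
  rw [h2, log2_ofReal (by positivity), Real.logb_pow, Real.logb_self_eq_one (by norm_num)] at h1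
  simpa using h1

theorem lenToEReal_natCast (n : ℕ) : lenToEReal (n : ℕ∞) = (n : EReal) := by
  simp only [lenToEReal, ENat.toENNReal_coe]
  rfl

theorem lenToEReal_top : lenToEReal ⊤ = ⊤ := by
  simp [lenToEReal]

theorem lenToEReal_ne_bot (k : ℕ∞) : lenToEReal k ≠ ⊥ := by
  unfold lenToEReal
  exact EReal.coe_ennreal_ne_bot _

/-- The bounds `2 ^ (d - 1) < t ≤ 2 ^ d` for the integer `d = ⌈log₂ t⌉`. -/
theorem zpow_ceil_log2 {t : ℝ≥0∞} (h0 : t ≠ 0) (ht : t ≠ ⊤) :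
    (2 : ℝ≥0∞) ^ (⌈(log2 t).toReal⌉ - 1) < t ∧ t ≤ (2 : ℝ≥0∞) ^ ⌈(log2 t).toReal⌉ := by
  have hpos : 0 < t.toReal := ENNReal.toReal_pos h0 ht
  have hcast : ∀ z : ℤ, (2 : ℝ≥0∞) ^ z = ENNReal.ofReal ((2 : ℝ) ^ (z : ℝ)) := by
    intro z
    rw [← ENNReal.ofReal_rpow_of_pos two_pos, ENNReal.rpow_intCast]
    norm_num
  obtain ⟨s, rfl⟩ : ∃ s, t = ENNReal.ofReal s := ⟨_, (ENNReal.ofReal_toReal ht).symm⟩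
  have hs : 0 < s := by
    rw [← ENNReal.ofReal_pos]
    exact pos_iff_ne_zero.2 h0
  rw [log2_ofReal hs, EReal.toReal_coe, hcast, hcast]
  constructor
  · rw [ENNReal.ofReal_lt_ofReal_iff hs, ← Real.lt_logb_iff_rpow_lt one_lt_two hs]
    push_cast
    linarith [Int.ceil_lt_add_one (Real.logb 2 s)]
  · refine ENNReal.ofReal_le_ofReal ?_
    rw [← Real.logb_le_iff_le_rpow one_lt_two hs]
    exact Int.le_ceil _

/-- The numerator of `2 ^ z`, for the integer `z` with code `d`. -/
def zpowNum (d : ℕ) : ℕ := if d % 2 = 0 then 2 ^ (d / 2) else 1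

/-- The denominator of `2 ^ z`, for the integer `z` with code `d`. -/
def zpowDen (d : ℕ) : ℕ := if d % 2 = 0 then 1 else 2 ^ (d / 2 + 1)

theorem primrec_zpowNum : Primrec zpowNum :=
  Primrec.ite (Primrec.eq.comp (Primrec.nat_mod.comp .id (.const 2)) (.const 0))
    (primrec_two_pow.comp (Primrec.nat_div.comp .id (.const 2))) (.const 1)

theorem primrec_zpowDen : Primrec zpowDen :=
  Primrec.ite (Primrec.eq.comp (Primrec.nat_mod.comp .id (.const 2)) (.const 0)) (.const 1)
    (primrec_two_pow.comp (Primrec.succ.comp (Primrec.nat_div.comp .id (.const 2))))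

theorem zpowNum_pos (d : ℕ) : 0 < zpowNum d := by
  unfold zpowNum
  split <;> positivity

theorem zpowDen_pos (d : ℕ) : 0 < zpowDen d := by
  unfold zpowDen
  split <;> positivity

/-- The weight `2 ^ (z - 1)`, for the integer `z` with code `d`. -/
noncomputable def codeWeight (d : ℕ) : ℝ≥0∞ := (2 : ℝ≥0∞) ^ (Equiv.intEquivNat.symm d - 1)

theorem codeWeight_intEquivNat (z : ℤ) : codeWeight (Equiv.intEquivNat z) = 2 ^ (z - 1) := by
  rw [codeWeight, Equiv.symm_apply_apply]

theorem codeWeight_ne_zero (d : ℕ) : codeWeight d ≠ 0 :=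
  (ENNReal.zpow_pos (by simp) (by simp) _).ne'

theorem codeWeight_ne_top (d : ℕ) : codeWeight d ≠ ⊤ :=
  (ENNReal.zpow_lt_top (by simp) (by simp) _).ne

theorem codeWeight_eq (d : ℕ) : codeWeight d = (zpowNum d : ℝ≥0∞) / (2 * zpowDen d : ℕ) := by
  obtain ⟨z, rfl⟩ := Equiv.intEquivNat.surjective d
  rw [codeWeight_intEquivNat, ENNReal.zpow_sub (by simp) (by simp), zpow_one]
  rcases z with n | n
  · have h : Equiv.intEquivNat (Int.ofNat n) = 2 * n := rfl
    rw [h]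
    simp [zpowNum, zpowDen, div_eq_mul_inv]
  · have h : Equiv.intEquivNat (Int.negSucc n) = 2 * n + 1 := rfl
    have h1 : (2 * n + 1) % 2 = 1 := by omega
    have h2 : (2 * n + 1) / 2 = n := by omega
    rw [h]
    simp only [zpowNum, zpowDen, h1, h2, zpow_negSucc]
    simp [div_eq_mul_inv, ENNReal.mul_inv, mul_comm]

theorem frac_eq_div {m : ℕ} (hm : 0 < m) (k : ℕ) : frac k (m - 1) = (k : ℝ≥0∞) / m := by
  have h : ((m - 1 : ℕ) : ℝ≥0∞) + 1 = m := by exact_mod_cast Nat.sub_add_cancel hm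
  rw [frac, h]

theorem lsc_codeWeight : LSC codeWeight := by
  refine (LSC.frac primrec_zpowNum (Primrec.pred.comp (Primrec.nat_mul.comp (.const 2)
    primrec_zpowDen))).of_eq fun d => ?_
  rw [codeWeight_eq]
  exact frac_eq_div (Nat.mul_pos two_pos (zpowDen_pos d)) _

theorem lsc_codeWeight_inv : LSC fun d => (codeWeight d)⁻¹ := by
  refine (LSC.frac (Primrec.nat_mul.comp (.const 2) primrec_zpowDen)
    (Primrec.pred.comp primrec_zpowNum)).of_eq fun d => ?_
  rw [codeWeight_eq, ENNReal.inv_div (Or.inl (ENNReal.natCast_ne_top _)) (Or.inl (by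
    have := zpowDen_pos d
    norm_cast
    omega))]
  exact frac_eq_div (zpowNum_pos d) _

/-! ### The bound on the future -/

section Deficiency

variable {X : Type*}

/-- An enumerable condition for `2 ^ (z - 1) * ρ x ≤ M x`, where `d` is the code of `z`: the value
`ρ x` is bounded from above by one minus the values at the other strings of the same length. If `ρ`
is a measure, this bound is exact. -/
def Exceeds (M ρ : List X → ℝ≥0∞) (d : ℕ) (x : List X) : Prop :=
  1 < (codeWeight d)⁻¹ * M x + levelSum x.length fun w => ind (w ≠ x) * ρ w

/-- The values at the strings of the length of `x`, with `x` itself split off. -/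
theorem levelSum_split (ρ : List X → ℝ≥0∞) (x : List X) :
    ρ x + levelSum x.length (fun w => ind (w ≠ x) * ρ w) = levelSum x.length ρ := by
  have h : ρ x = ∑' w, ind (w.length = x.length) * (ind (w = x) * ρ w) := by
    rw [tsum_eq_single x]
    · simp [ind]
    · intro w hw
      simp [ind, hw]
  rw [h]
  unfold levelSum
  rw [← ENNReal.tsum_add]
  refine tsum_congr fun w => ?_
  by_cases hw : w = x
  · simp [ind, hw]
  · simp [ind, hw]

theorem Exceeds.le [Fintype X] {M ρ : List X → ℝ≥0∞} (hρ : IsSemimeasure ρ) {d : ℕ} {x : List X}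
    (h : Exceeds M ρ d x) : codeWeight d * ρ x ≤ M x := by
  have h1 : ρ x + levelSum x.length (fun w => ind (w ≠ x) * ρ w) ≤ 1 := by
    rw [levelSum_split]
    exact (levelSum_le_of_superadditive hρ.2 _).trans hρ.1
  have h2 : ρ x ≤ (codeWeight d)⁻¹ * M x :=
    (lt_of_add_lt_add_right (h1.trans_lt h)).le
  calc codeWeight d * ρ x ≤ codeWeight d * ((codeWeight d)⁻¹ * M x) := mul_le_mul_right h2 _
    _ = M x := by
      rw [← mul_assoc, ENNReal.mul_inv_cancel (codeWeight_ne_zero d) (codeWeight_ne_top d), one_mul]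

theorem exceeds_of_lt [Fintype X] {M μ : List X → ℝ≥0∞} (hμ : IsStringMeasure μ) {d : ℕ} {x : List X}
    (h : codeWeight d * μ x < M x) : Exceeds M μ d x := by
  have h1 : μ x + levelSum x.length (fun w => ind (w ≠ x) * μ w) = 1 := by
    rw [levelSum_split, levelSum_eq_of_additive hμ.2, hμ.1]
  have h2 : μ x < (codeWeight d)⁻¹ * M x := by
    rw [mul_comm, ← div_eq_mul_inv]
    refine (ENNReal.lt_div_iff_mul_lt (Or.inl (codeWeight_ne_zero d))
      (Or.inl (codeWeight_ne_top d))).2 ?_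
    rwa [mul_comm]
  rw [Exceeds]
  refine h1.symm.trans_lt (ENNReal.add_lt_add_right ?_ h2)
  exact ne_top_of_le_ne_top ENNReal.one_ne_top (h1 ▸ le_add_self)

theorem re_exceeds [Primcodable X] {M : List X → ℝ≥0∞} (hM : LSC M) {ν : ℕ → List X → ℝ≥0∞}
    (hν : LSC fun a : ℕ × List X => ν a.1 a.2) :
    REPred fun t : (ℕ × ℕ) × List X => Exceeds M (ν t.1.1) t.1.2 t.2 := by
  have h1 : LSC fun t : (ℕ × ℕ) × List X => (codeWeight t.1.2)⁻¹ * M t.2 :=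
    (lsc_codeWeight_inv.comp (Primrec.snd.comp .fst)).mul (hM.comp .snd)
  have h2 : LSC fun a : ((ℕ × ℕ) × List X) × List X => ν a.1.1.1 a.2 :=
    hν.comp (k := fun a : ((ℕ × ℕ) × List X) × List X => (a.1.1.1, a.2))
      (Primrec.pair (Primrec.fst.comp (Primrec.fst.comp .fst)) .snd)
  have h3 : PrimrecPred fun a : ((ℕ × ℕ) × List X) × List X => a.2 ≠ a.1.2 := by
    classical
    exact PrimrecPred.not (Primrec.eq.comp .snd (Primrec.snd.comp .fst))
  have h4 := h1.add (LSC.levelSum (f := fun (t : (ℕ × ℕ) × List X) w =>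
    ind (w ≠ t.2) * ν t.1.1 w) ((LSC.ind (rePred_of_primrecPred h3)).mul h2) (Primrec.list_length.comp .snd))
  refine (rePred_comp h4.rePred_frac_lt (f := fun t => (t, 1, 0)) (.pair .id (.const _))).of_eq fun t => ?_
  simp [Exceeds, frac]

/-- The tests behind the bound: a tape that begins with a self-delimiting program for the code `d`
of an integer `z`, followed by a tape on which `x` determines `T`, carries the label `(T, d)`; its
weight function is `2 ^ (z - 1) * ν T`. -/
noncomputable def deficiencyTests [Fintype X] [Primcodable X] (U : PrefixMachine) (ν : ℕ → List X → ℝ≥0∞)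
    (hν : IsEffectiveEnumeration ν) (E : List Bool → List X → ℕ → Prop)
    (hre : REPred fun t : List Bool × List X × ℕ => E t.1 t.2.1 t.2.2)
    (hfun : ∀ p x m n, E p x m → E p x n → m = n)
    (hpro : ∀ p p' x x' n, E p x n → p <+: p' → x <+: x' → E p' x' n) :
    TestSystem X (ℕ × ℕ) where
  E r x l := ∃ k, l.2 ∈ U.run (r.take k) ∧ E (r.drop k) x l.1
  A l x := Exceeds (solomonoff U ν) (ν l.1) l.2 x
  ψ l x := codeWeight l.2 * ν l.1 x
  M := solomonoff U ν
  re_E := by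
    have hr : Primrec fun t : (List Bool × List X × ℕ × ℕ) × ℕ => t.1.1 := Primrec.fst.comp .fst
    have hx : Primrec fun t : (List Bool × List X × ℕ × ℕ) × ℕ => t.1.2.1 :=
      Primrec.fst.comp (Primrec.snd.comp .fst)
    have hl : Primrec fun t : (List Bool × List X × ℕ × ℕ) × ℕ => t.1.2.2 :=
      Primrec.snd.comp (Primrec.snd.comp .fst)
    have h1 : REPred fun t : (List Bool × List X × ℕ × ℕ) × ℕ =>
        t.1.2.2.2 ∈ U.run (t.1.1.take t.2) :=
      rePred_comp (rePred_mem_of_partrec U.partrec)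
        (f := fun t : (List Bool × List X × ℕ × ℕ) × ℕ => (t.1.1.take t.2, t.1.2.2.2))
        (Primrec.pair (Primrec.list_take.comp .snd hr) (Primrec.snd.comp hl)).to_comp
    have h2 : REPred fun t : (List Bool × List X × ℕ × ℕ) × ℕ =>
        E (t.1.1.drop t.2) t.1.2.1 t.1.2.2.1 :=
      rePred_comp hre (f := fun t : (List Bool × List X × ℕ × ℕ) × ℕ =>
        (t.1.1.drop t.2, t.1.2.1, t.1.2.2.1))
        (Primrec.pair (Primrec.list_drop.comp .snd hr)
          (Primrec.pair hx (Primrec.fst.comp hl))).to_comp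
    exact rePred_exists (p := fun (t : List Bool × List X × ℕ × ℕ) k =>
      t.2.2.2 ∈ U.run (t.1.take k) ∧ E (t.1.drop k) t.2.1 t.2.2.1) (rePred_and h1 h2)
  functional := by
    rintro r x ⟨T, d⟩ ⟨T', d'⟩ ⟨k, h1, h2⟩ ⟨k', h1', h2'⟩
    -- Two programs on the same tape are comparable, hence equal.
    have hk : r.take k = r.take k' := by
      rcases List.prefix_or_prefix_of_prefix (List.take_prefix k r) (List.take_prefix k' r)
        with h | h
      · exact U.prefixFree _ _ (Part.dom_iff_mem.2 ⟨_, h1⟩) (Part.dom_iff_mem.2 ⟨_, h1'⟩) h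
      · exact (U.prefixFree _ _ (Part.dom_iff_mem.2 ⟨_, h1'⟩) (Part.dom_iff_mem.2 ⟨_, h1⟩) h).symm
    have hd : r.drop k = r.drop k' := by
      have := (List.take_append_drop k r).trans (List.take_append_drop k' r).symm
      rw [hk] at this
      exact List.append_cancel_left this
    rw [hk] at h1
    rw [hd] at h2
    exact Prod.ext (hfun _ _ _ _ h2 h2') (Part.mem_unique h1 h1')
  prolong := by
    rintro r _ x x' l ⟨k, h1, h2⟩ ⟨s, rfl⟩ hx
    have ht : (r ++ s).take (min k r.length) = r.take k := by
      rw [List.take_append_of_le_length (min_le_right _ _), ← List.take_eq_take_min]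
    have hd : (r ++ s).drop (min k r.length) = r.drop k ++ s := by
      have h := List.take_append_drop (min k r.length) (r ++ s)
      rw [ht] at h
      refine List.append_cancel_left (h.trans ?_)
      rw [← List.append_assoc, List.take_append_drop]
    exact ⟨min k r.length, by rwa [ht],
      by rw [hd]; exact hpro _ _ _ _ _ h2 (List.prefix_append _ _) hx⟩
  re_A := re_exceeds (lsc_solomonoff U hν.lsc) hν.lsc
  lsc_ψ := by
    have h1 : LSC fun t : (ℕ × ℕ) × List X => codeWeight t.1.2 :=
      lsc_codeWeight.comp (Primrec.snd.comp .fst)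
    have h2 : LSC fun t : (ℕ × ℕ) × List X => ν t.1.1 t.2 :=
      hν.lsc.comp (k := fun t : (ℕ × ℕ) × List X => (t.1.1, t.2))
        (Primrec.pair (Primrec.fst.comp .fst) .snd)
    exact h1.mul h2
  ψ_superadditive l x := by
    rw [← Finset.mul_sum]
    exact mul_le_mul_right ((hν.1 l.1).2 x) _
  semimeasure_M := isSemimeasure_solomonoff U hν.1
  ψ_le l x h := h.le (hν.1 l.1)

/-- Solomonoff's prior keeps a deficiency of the measure `μ`, once it is reached at `x`, at all
prolongations of `x`, up to the weights of programs for `μ` and for the deficiency. -/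
theorem exists_const_le_solomonoff [Fintype X] [Primcodable X] {U : PrefixMachine} (hU : U.IsOptimal)
    {ν : ℕ → List X → ℝ≥0∞} (hν : IsEffectiveEnumeration ν)
    {E : List Bool → List X → ℕ → Prop}
    (hre : REPred fun t : List Bool × List X × ℕ => E t.1 t.2.1 t.2.2)
    (hfun : ∀ p x m n, E p x m → E p x n → m = n)
    (hpro : ∀ p p' x x' n, E p x n → p <+: p' → x <+: x' → E p' x' n) :
    ∃ c : ℕ, ∀ (T : ℕ) (p q : List Bool) (x y : List X) (z : ℤ), IsStringMeasure (ν T) →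
      E p x T → Equiv.intEquivNat z ∈ U.run q →
      (2 : ℝ≥0∞) ^ (z - 1) * ν T x < solomonoff U ν x →
      (2⁻¹ : ℝ≥0∞) ^ (p.length + q.length + c) * (2 ^ (z - 1) * ν T (x ++ y)) ≤
        solomonoff U ν (x ++ y) := by
  obtain ⟨ρ, hρ, hlsc, h⟩ := (deficiencyTests U ν hν E hre hfun hpro).exists_semimeasure
  obtain ⟨T₀, rfl⟩ := hν.2.2 ρ hρ hlsc.rePred_frac_lt
  obtain ⟨c, hc⟩ := ENat.ne_top_iff_exists.1 (hU.K_ne_top T₀)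
  refine ⟨c, fun T p q x y z hT hp hq hz => ?_⟩
  rw [← codeWeight_intEquivNat] at hz ⊢
  have h1 := h (q ++ p) x (T, Equiv.intEquivNat z) ⟨q.length, by simpa using hq, by simpa using hp⟩
    (exceeds_of_lt hT hz) (fun w => (Finset.mul_sum ..).symm.trans (congrArg _ (hT.2 w)))
    (x ++ y) (List.prefix_append x y)
  refine le_trans ?_ (le_solomonoff U ν T₀ (x ++ y))
  rw [← hc, twoPowNeg_coe, pow_add, mul_comm (_ ^ (_ + _)), mul_assoc]
  refine mul_le_mul_right ?_ _
  rw [List.length_append, add_comm] at h1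
  exact h1

end Deficiency

end AIT

theorem theorem3 {X : Type*} [Fintype X] [Primcodable X]
    (U : AIT.PrefixMachine) (hU : U.IsOptimal)
    (ν : ℕ → List X → ℝ≥0∞) (hν : AIT.IsEffectiveEnumeration ν)
    (Kstar : ℕ → List X → ℕ∞) (hKstar : AIT.IsKStar Kstar) :
    ∃ c : ℕ, ∀ μ : List X → ℝ≥0∞, AIT.IsComputableMeasure μ →
      ∀ κ : List X → List X → ℝ≥0∞, AIT.IsCondVersion μ κ →
      ∀ T : ℕ, ν T = μ → ∀ x y : List X,
        AIT.log2 (κ x y / AIT.condVal (AIT.solomonoff U ν) x y) ≤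
          AIT.lenToEReal (Kstar T x) +
            AIT.lenToEReal (U.KCeil (AIT.deficiency (AIT.solomonoff U ν) μ x)) +
            (c : EReal) := by
  open AIT in
  obtain ⟨E, hre, hfun, hpro, hE⟩ := hKstar.exists_enumerable
  obtain ⟨c, hc⟩ := exists_const_le_solomonoff hU hν hre hfun hpro
  refine ⟨c + 1, ?_⟩
  rintro μ ⟨hμ, -⟩ κ hκ T rfl x y
  set M := solomonoff U ν with hM
  have hMsemi : IsSemimeasure M := isSemimeasure_solomonoff U hν.1
  -- A summand `⊤` makes the bound trivial, since no summand is `⊥`.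
  have htop : ∀ a b : EReal, a ≠ ⊥ → b ≠ ⊥ → a = ⊤ ∨ b = ⊤ → a + b + ((c + 1 : ℕ) : EReal) = ⊤ := by
    rintro a b ha hb (rfl | rfl)
    · rw [EReal.top_add_of_ne_bot hb, EReal.top_add_of_ne_bot (EReal.natCast_ne_bot _)]
    · rw [EReal.add_top_of_ne_bot ha, EReal.top_add_of_ne_bot (EReal.natCast_ne_bot _)]
  rcases hE T x with hK | ⟨p, hp, hK⟩
  · rw [htop _ _ (lenToEReal_ne_bot _) (lenToEReal_ne_bot _)
      (Or.inl (by rw [hK, lenToEReal_top]))]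
    exact le_top
  by_cases hdef : deficiency M (ν T) x = ⊤ ∨ deficiency M (ν T) x = ⊥
  · rw [htop _ _ (lenToEReal_ne_bot _) (lenToEReal_ne_bot _)
      (Or.inr (by rw [PrefixMachine.KCeil, if_pos hdef, lenToEReal_top]))]
    exact le_top
  set z : ℤ := ⌈(deficiency M (ν T) x).toReal⌉ with hz
  have hKC : U.KCeil (deficiency M (ν T) x) = U.K (Equiv.intEquivNat z) := by
    rw [PrefixMachine.KCeil, if_neg hdef, PrefixMachine.KInt]
  rw [hKC]
  rcases U.K_eq_top_or_attained (Equiv.intEquivNat z) with hq | ⟨q, hq, hq'⟩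
  · exact absurd hq (hU.K_ne_top _)
  have hM0 : M x / ν T x ≠ 0 := fun h => hdef (Or.inr (by rw [deficiency, h, log2_zero]))
  have hM1 : M x / ν T x ≠ ⊤ := fun h => hdef (Or.inl (by rw [deficiency, h, log2_top]))
  have hMx : M x ≠ 0 := fun h => hM0 (by rw [h, ENNReal.zero_div])
  have hMtop : M x ≠ ⊤ := ne_top_of_le_ne_top ENNReal.one_ne_top (hMsemi.le_one x)
  have hμx : ν T x ≠ 0 := fun h => hM1 (by rw [h, ENNReal.div_zero hMx])
  have hμtop : ν T x ≠ ⊤ := ne_top_of_le_ne_top ENNReal.one_ne_top ((hν.1 T).le_one x)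
  obtain ⟨hlow, hup⟩ := zpow_ceil_log2 hM0 hM1
  rw [← deficiency, ← hz] at hlow hup
  have hlow' : (2 : ℝ≥0∞) ^ (z - 1) * ν T x < M x :=
    (ENNReal.lt_div_iff_mul_lt (Or.inl hμx) (Or.inl hμtop)).1 hlow
  have hup' : M x ≤ 2 ^ z * ν T x := (ENNReal.div_le_iff hμx hμtop).1 hup
  have hfut := hc T p q x y z hμ hp hq hlow'
  rw [hK, hq', lenToEReal_natCast, lenToEReal_natCast]
  have hlog : log2 (κ x y / condVal M x y) ≤ ((p.length + q.length + (c + 1) : ℕ) : EReal) := by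
    refine log2_le_natCast (ENNReal.div_le_of_le_mul ?_)
    rw [hκ x y hμx, condVal]
    refine ENNReal.div_le_of_le_mul ?_
    set N := p.length + q.length + c with hN
    have h2 : ∀ n : ℕ, (2 : ℝ≥0∞) ^ n * 2⁻¹ ^ n = 1 := fun n => by
      rw [← mul_pow, ENNReal.mul_inv_cancel (by simp) (by simp), one_pow]
    have h3 := ENNReal.zpow_add (x := 2) (by simp) (by simp) 1 (z - 1)
    rw [zpow_one, add_sub_cancel] at h3
    calc ν T (x ++ y) = M x / M x * ν T (x ++ y) := by rw [ENNReal.div_self hMx hMtop, one_mul]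
      _ ≤ 2 ^ z * ν T x / M x * ν T (x ++ y) :=
        mul_le_mul_left (ENNReal.div_le_div_right hup' _) _
      _ = 2 ^ (N + 1) * ((2⁻¹ ^ N * (2 ^ (z - 1) * ν T (x ++ y))) / M x) * ν T x := by
        rw [h3, pow_succ, div_eq_mul_inv, div_eq_mul_inv]
        calc _ = 1 * (2 * 2 ^ (z - 1) * ν T x * (M x)⁻¹ * ν T (x ++ y)) := (one_mul _).symm
          _ = _ := by rw [← h2 N]; ring
      _ ≤ 2 ^ (N + 1) * (M (x ++ y) / M x) * ν T x :=
        mul_le_mul_left (mul_le_mul_right (ENNReal.div_le_div_right hfut _) _) _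
      _ = _ := by rw [hN]; ring_nf
  refine hlog.trans (le_of_eq ?_)
  push_cast
  ring_nf
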